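/- Let $\mathrm{Ai}(x)=\frac1\pi\int_0^\infty\cos\left(\frac{t^3}{3}+xt\right)dt$ (improper integral) be the Airy function. For $c\in\mathbb R$ let $\mathcal T_c$ be the Airy integral operator on the real space $L^2[0,\infty)$, $\mathcal T_c[\phi](x)=\int_0^\infty \mathrm{Ai}(x+y+c)\,\phi(y)\,dy$. Let $\lambda_{0,c}$ denote an eigenvalue of $\mathcal T_c$ of largest absolute value, and $\psi_{0,c}$ an associated eigenfunction with $\|\psi_{0,c}\|_{L^2[0,\infty)}=1$ (of either sign, so in particular the one with $\psi_{0,c}(0)>0$). Let $a,b\in\mathbb R$. Call $f\colon\mathbb R\to\mathbb R$ Airy-bandlimited with Airy transform $\sigma$ supported on $[a,\infty)$ if $\sigma\in L^2(\mathbb R)$ is real-valued, vanishes almost everywhere on $(-\infty,a)$, and $f(x)=\int_a^\infty \mathrm{Ai}(x+y)\,\sigma(y)\,dy$ for all $x\in\mathbb R$. **Theorem.** Such $\lambda_{0,a+b}$ and $\psi_{0,a+b}$ exist. For every nonzero Airy-bandlimited $f$ with Airy transform supported on $[a,\infty)$, the function $f^2$ is integrable with $\int_{-\infty}^\infty f^2\,dx>0$,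 so that $$\alpha^2=\frac{\int_b^\infty f^2\,dx}{\int_{-\infty}^\infty f^2\,dx}$$ is well defined. Over all such $f$, the maximum of $\alpha^2$ exists and equals $\lambda_{0,a+b}^2$. It is attained by the function $f$ whose Airy transform is $\sigma(y)=\psi_{0,a+b}(y-a)$ for $y\ge a$ and $\sigma(y)=0$ for $y<a$; this $f$ is nonzero. In particular $\alpha^2\le\lambda_{0,a+b}^2$ is a tight inequality, and it refines the bound $\alpha^2\le\int_b^\infty\int_a^\infty \mathrm{Ai}(x+y)^2\,dy\,dx$, that is, $$\lambda_{0,a+b}^2\le\int_b^\infty\!\!\int_a^\infty \mathrm{Ai}(x+y)^2\,dy\,dx .$$ -/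

import Mathlib

open MeasureTheory Set Filter Topology

noncomputable section

/-- The Airy function of the first kind on the real line, given by the (conditionally convergent)
improper integral `(1/π) ∫_0^∞ cos (t³/3 + x t) dt`. -/
def airyAi (x : ℝ) : ℝ :=
  limUnder atTop
    (fun R : ℝ => (1 / Real.pi) * ∫ t in (0 : ℝ)..R, Real.cos (t ^ 3 / 3 + x * t))

/-- The Airy integral operator with parameter `c`, acting on (representatives of) elements of the
real space `L²[0,∞)`:  `f ↦ ∫_0^∞ Ai(x + y + c) f(y) dy`. -/
def airyOp (c : ℝ) (f : ℝ → ℝ) (x : ℝ) : ℝ :=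
  ∫ y in Ici (0 : ℝ), airyAi (x + y + c) * f y

/-- `ψ` (only its values on `[0,∞)` matter) is an `L²[0,∞)`-normalized eigenfunction of the Airy
integral operator with parameter `c`, with eigenvalue `lam`. -/
structure IsAiryEigenfunction (c lam : ℝ) (ψ : ℝ → ℝ) : Prop where
  memLp : MemLp ψ 2 (volume.restrict (Ici (0 : ℝ)))
  norm_sq : ∫ x in Ici (0 : ℝ), ψ x ^ 2 = 1
  eigen : ∀ x : ℝ, 0 ≤ x → airyOp c ψ x = lam * ψ x

/-- `lam` is an eigenvalue of the Airy integral operator on `L²[0,∞)` with parameter `c`. -/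
def IsAiryEigenvalue (c lam : ℝ) : Prop :=
  ∃ ψ : ℝ → ℝ, IsAiryEigenfunction c lam ψ

/-- `lam` is the first eigenvalue (the one of largest absolute value) of the Airy integral operator
with parameter `c`, and `ψ` is a normalized eigenfunction for it (of either sign). -/
structure IsFirstAiryEigenpair (c lam : ℝ) (ψ : ℝ → ℝ) : Prop where
  eigenfunction : IsAiryEigenfunction c lam ψ
  largest : ∀ μ : ℝ, IsAiryEigenvalue c μ → |μ| ≤ |lam|

/-- The function `x ↦ ∫_a^∞ Ai(x + y) σ(y) dy`: the Airy transform of a function `σ` that is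
supported on `[a,∞)`. -/
def airyTransformFrom (a : ℝ) (σ : ℝ → ℝ) (x : ℝ) : ℝ :=
  ∫ y in Ici a, airyAi (x + y) * σ y

/-- `f` is Airy-bandlimited, with a (real, square-integrable) Airy transform `σ` that is supported
on `[a,∞)`. -/
structure IsAiryBandlimited (a : ℝ) (f σ : ℝ → ℝ) : Prop where
  memLp : MemLp σ 2 volume
  supported : ∀ᵐ y : ℝ, y < a → σ y = 0
  repr : ∀ x : ℝ, f x = airyTransformFrom a σ x

/-- The proportion `α² = ∫_b^∞ f² / ∫_{-∞}^∞ f²` of the energy of `f` on `[b,∞)`. -/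
def energyFraction (b : ℝ) (f : ℝ → ℝ) : ℝ :=
  (∫ x in Ici b, f x ^ 2) / ∫ x, f x ^ 2

/-- The translate `y ↦ ψ(y - a)` of a function `ψ` on `[0,∞)`, a function on `[a,∞)` that is
extended by zero to the real line. -/
def translateFrom (a : ℝ) (ψ : ℝ → ℝ) : ℝ → ℝ :=
  (Ici a).indicator (fun y => ψ (y - a))

end

/-! On the Fourier side, convolution with `airyAi` is multiplication by exp(i(2πs)³/3), which is
unimodular. Hence the Airy transform preserves the `L²` norm, and ∫ f² = ∫ σ². Substituting x + b
and y + a turns f on [b,∞) into T φ, where T is the Airy operator with parameter a + b and φ = σ(· +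
a). So α² = ‖T φ‖² / ‖φ‖², whose supremum is ‖T‖². T is symmetric and Hilbert–Schmidt, hence
compact, so ‖T‖ is attained at an eigenvector whose eigenvalue has modulus ‖T‖, the largest
possible. Cauchy–Schwarz in y bounds λ² by the squared Hilbert–Schmidt norm.

The delicate point is Parseval (`airyTransformFrom_isometry`), as the Airy integral converges only
conditionally. Shifting its contour to height η > 0 gives a kernel `dampedAiry η` whose multiplier
carries a Gaussian factor, so Fubini and Plancherel for L¹ ∩ L² apply. The limit η → 0 is taken with
`eLpNorm_eq_of_tendsto_of_isometric`. The shift also yields |Ai(x)| ≤ exp(-x), which dominates the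
kernel, and Ai > 0 on [4,∞), which shows T ≠ 0. -/

/-! ### Plancherel for L¹ ∩ L² -/

section Plancherel

open FourierTransform SchwartzMap

/-- The `L²` Fourier transform of an integrable function is given by the Fourier integral. -/
theorem MeasureTheory.MemLp.coeFn_fourier_toLp {g : ℝ → ℂ} (hg1 : Integrable g)
    (hg : MemLp g 2 volume) : (𝓕 (hg.toLp g) : Lp ℂ 2 (volume : Measure ℝ)) =ᵐ[volume] 𝓕 g := by
  have hcont : Continuous (𝓕 g) :=
    VectorFourier.fourierIntegral_continuous Real.continuous_fourierChar continuous_inner hg1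
  have h0 : ∀ᵐ x : ℝ, ((𝓕 (hg.toLp g) : Lp ℂ 2 (volume : Measure ℝ)) x - 𝓕 g x) = 0 := by
    have hl1 : LocallyIntegrable (𝓕 (hg.toLp g) : Lp ℂ 2 (volume : Measure ℝ)) volume :=
      (Lp.memLp _).locallyIntegrable (by norm_num)
    have hl2 : LocallyIntegrable (𝓕 g) volume := hcont.locallyIntegrable
    -- The `L²` transform agrees with the distributional one, so both sides have the same pairing
    -- with every test function.
    apply ae_eq_zero_of_integral_contDiff_smul_eq_zero (hl1.sub hl2)
    intro u u_smooth u_cpt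
    have hu₁ : HasCompactSupport (Complex.ofRealCLM ∘ u) := u_cpt.comp_left rfl
    have hu₂ : ContDiff ℝ (↑(⊤ : ℕ∞)) (Complex.ofRealCLM ∘ u) := by fun_prop
    let φ : 𝓢(ℝ, ℂ) := hu₁.toSchwartzMap hu₂
    have key := DFunLike.congr_fun (Lp.fourier_toTemperedDistribution_eq (hg.toLp g)) φ
    rw [TemperedDistribution.fourier_apply, Lp.toTemperedDistribution_apply,
      Lp.toTemperedDistribution_apply] at key
    have e1 : ∫ x, (𝓕 φ) x • (hg.toLp g) x = ∫ x, (𝓕 φ) x • g x := by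
      apply integral_congr_ae
      filter_upwards [hg.coeFn_toLp] with x hx
      rw [hx]
    have e2 : ∫ x, (𝓕 φ) x • g x = ∫ x, φ x • 𝓕 g x := by
      rw [SchwartzMap.fourier_coe]
      have h := VectorFourier.integral_fourierIntegral_smul_eq_flip (L := innerₗ ℝ)
        Real.continuous_fourierChar continuous_inner (φ.integrable (μ := volume)) hg1
      rw [flip_innerₗ] at h
      exact h
    have hφ : ∀ x, φ x = (u x : ℂ) := fun x => rfl
    rw [e1, e2] at key
    simp only [hφ] at key
    have i1 := hl1.integrable_smul_left_of_hasCompactSupport u_smooth.continuous u_cpt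
    have i2 := hl2.integrable_smul_left_of_hasCompactSupport u_smooth.continuous u_cpt
    have : ∫ x, u x • ((𝓕 (hg.toLp g) : Lp ℂ 2 (volume : Measure ℝ)) x - 𝓕 g x)
        = (∫ x, u x • (𝓕 (hg.toLp g) : Lp ℂ 2 (volume : Measure ℝ)) x) - ∫ x, u x • 𝓕 g x := by
      simp_rw [smul_sub]
      exact integral_sub i1 i2
    simp only [Pi.sub_apply]
    rw [this, sub_eq_zero]
    simpa [smul_eq_mul] using key.symm
  filter_upwards [h0] with x hx
  exact sub_eq_zero.mp hx

/-- **Plancherel's theorem** for functions in `L¹ ∩ L²`. -/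
theorem MeasureTheory.MemLp.fourier_of_integrable {g : ℝ → ℂ} (hg1 : Integrable g)
    (hg : MemLp g 2 volume) :
    MemLp (𝓕 g) 2 volume ∧ eLpNorm (𝓕 g) 2 volume = eLpNorm g 2 volume := by
  have h := hg.coeFn_fourier_toLp hg1
  refine ⟨(memLp_congr_ae h).1 (Lp.memLp _), ?_⟩
  rw [← eLpNorm_congr_ae h, ← eLpNorm_congr_ae hg.coeFn_toLp, ← Lp.enorm_def, ← Lp.enorm_def]
  rw [← ofReal_norm, ← ofReal_norm, Lp.norm_fourier_eq]

/-- **Plancherel's theorem** for the inverse Fourier transform of functions in `L¹ ∩ L²`. -/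
theorem MeasureTheory.MemLp.fourierInv_of_integrable {g : ℝ → ℂ} (hg1 : Integrable g)
    (hg : MemLp g 2 volume) :
    MemLp (𝓕⁻ g) 2 volume ∧ eLpNorm (𝓕⁻ g) 2 volume = eLpNorm g 2 volume := by
  have h := hg.fourier_of_integrable hg1
  have hinv : 𝓕⁻ g = 𝓕 g ∘ Neg.neg := by
    ext x; exact Real.fourierInv_eq_fourier_neg g x
  have hmp := Measure.measurePreserving_neg (volume : Measure ℝ)
  rw [hinv]
  exact ⟨h.1.comp_measurePreserving hmp, by
    rw [eLpNorm_comp_measurePreserving h.1.aestronglyMeasurable hmp, h.2]⟩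

end Plancherel

/-! ### Isometries under pointwise limits -/

section LimitIsometry

/-- If `g n → g` in `L²`, if `f n` converges pointwise almost everywhere to `f`, and if
`‖f n - f m‖ = ‖g n - g m‖` and `‖f n‖ = ‖g n‖`, then `f` is in `L²` and `‖f‖ = ‖g‖`. -/
theorem eLpNorm_eq_of_tendsto_of_isometric {α β E F : Type*} [MeasurableSpace α]
    [MeasurableSpace β] {μ : Measure α} {ν : Measure β} [NormedAddCommGroup E]
    [NormedAddCommGroup F] {f : ℕ → α → E} {g : ℕ → β → F} {f' : α → E} {g' : β → F}
    (hf : ∀ n, AEStronglyMeasurable (f n) μ) (hg : ∀ n, MemLp (g n) 2 ν) (hg' : MemLp g' 2 ν)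
    (hlim : ∀ᵐ x ∂μ, Tendsto (fun n => f n x) atTop (𝓝 (f' x)))
    (hglim : Tendsto (fun n => eLpNorm (g n - g') 2 ν) atTop (𝓝 0))
    (hnorm : ∀ n, eLpNorm (f n) 2 μ = eLpNorm (g n) 2 ν)
    (hsub : ∀ n m, eLpNorm (f n - f m) 2 μ = eLpNorm (g n - g m) 2 ν) :
    MemLp f' 2 μ ∧ eLpNorm f' 2 μ = eLpNorm g' 2 ν := by
  have hf'm : AEStronglyMeasurable f' μ := aestronglyMeasurable_of_tendsto_ae atTop hf hlim
  -- Fatou's lemma for f m - f n as m → ∞: the isometry moves the bound to the g side, where `L²`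
  -- convergence is known.
  have hdiff : ∀ n, eLpNorm (f' - f n) 2 μ ≤ eLpNorm (g n - g') 2 ν := by
    intro n
    have h1 : eLpNorm (f' - f n) 2 μ ≤ liminf (fun m => eLpNorm (f m - f n) 2 μ) atTop := by
      refine Lp.eLpNorm_lim_le_liminf_eLpNorm (fun m => (hf m).sub (hf n)) _ ?_
      filter_upwards [hlim] with x hx
      exact hx.sub_const _
    refine h1.trans ?_
    have h2 : ∀ m, eLpNorm (f m - f n) 2 μ ≤ eLpNorm (g m - g') 2 ν + eLpNorm (g n - g') 2 ν := by
      intro m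
      rw [hsub, eLpNorm_sub_comm (g n) g']
      have : g m - g n = (g m - g') + (g' - g n) := by abel
      rw [this]
      exact eLpNorm_add_le ((hg m).1.sub hg'.1) (hg'.1.sub (hg n).1) (by norm_num)
    have h3 : Tendsto (fun m => eLpNorm (g m - g') 2 ν + eLpNorm (g n - g') 2 ν) atTop
        (𝓝 (0 + eLpNorm (g n - g') 2 ν)) := hglim.add_const _
    rw [zero_add] at h3
    exact (liminf_le_liminf (Eventually.of_forall h2)).trans_eq h3.liminf_eq
  have hA : eLpNorm f' 2 μ ≤ eLpNorm g' 2 ν := by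
    have h : ∀ n, eLpNorm f' 2 μ ≤ eLpNorm g' 2 ν + 2 * eLpNorm (g n - g') 2 ν := by
      intro n
      calc eLpNorm f' 2 μ = eLpNorm (f n + (f' - f n)) 2 μ := by congr 1; abel
        _ ≤ eLpNorm (f n) 2 μ + eLpNorm (f' - f n) 2 μ :=
          eLpNorm_add_le (hf n) (hf'm.sub (hf n)) (by norm_num)
        _ ≤ eLpNorm (g' + (g n - g')) 2 ν + eLpNorm (g n - g') 2 ν := by
          rw [hnorm, add_sub_cancel]; gcongr; exact hdiff n
        _ ≤ (eLpNorm g' 2 ν + eLpNorm (g n - g') 2 ν) + eLpNorm (g n - g') 2 ν := by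
          gcongr; exact eLpNorm_add_le hg'.1 ((hg n).1.sub hg'.1) (by norm_num)
        _ = _ := by rw [add_assoc, two_mul]
    have h3 : Tendsto (fun n => eLpNorm g' 2 ν + 2 * eLpNorm (g n - g') 2 ν) atTop
        (𝓝 (eLpNorm g' 2 ν + 2 * 0)) :=
      (ENNReal.Tendsto.const_mul hglim (Or.inr (by norm_num))).const_add _
    simpa using ge_of_tendsto' h3 h
  have hB : eLpNorm g' 2 ν ≤ eLpNorm f' 2 μ := by
    have h : ∀ n, eLpNorm g' 2 ν ≤ eLpNorm f' 2 μ + 2 * eLpNorm (g n - g') 2 ν := by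
      intro n
      calc eLpNorm g' 2 ν = eLpNorm (g n + (g' - g n)) 2 ν := by congr 1; abel
        _ ≤ eLpNorm (g n) 2 ν + eLpNorm (g' - g n) 2 ν :=
          eLpNorm_add_le (hg n).1 (hg'.1.sub (hg n).1) (by norm_num)
        _ = eLpNorm (f' + (f n - f')) 2 μ + eLpNorm (g n - g') 2 ν := by
          rw [← hnorm, add_sub_cancel, eLpNorm_sub_comm]
        _ ≤ (eLpNorm f' 2 μ + eLpNorm (g n - g') 2 ν) + eLpNorm (g n - g') 2 ν := by
          gcongr
          refine (eLpNorm_add_le hf'm ((hf n).sub hf'm) (by norm_num)).trans ?_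
          gcongr
          rw [eLpNorm_sub_comm]
          exact hdiff n
        _ = _ := by rw [add_assoc, two_mul]
    have h3 : Tendsto (fun n => eLpNorm f' 2 μ + 2 * eLpNorm (g n - g') 2 ν) atTop
        (𝓝 (eLpNorm f' 2 μ + 2 * 0)) :=
      (ENNReal.Tendsto.const_mul hglim (Or.inr (by norm_num))).const_add _
    simpa using ge_of_tendsto' h3 h
  exact ⟨⟨hf'm, hA.trans_lt hg'.2⟩, le_antisymm hA hB⟩

end LimitIsometry

/-! ### Compact symmetric operators -/

section CompactSymmetric

variable {E : Type*} [NormedAddCommGroup E] [InnerProductSpace ℝ E] [CompleteSpace E]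

/-- A symmetric operator that is square-summable on an orthonormal basis is compact. -/
theorem ContinuousLinearMap.isCompactOperator_of_summable_norm_sq {ι : Type*} (T : E →L[ℝ] E)
    (hT : T.IsSymmetric) (e : HilbertBasis ι ℝ E) (hsum : Summable fun i => ‖T (e i)‖ ^ 2) :
    IsCompactOperator T := by
  classical
  -- By symmetry ⟪e i, T f⟫ = ⟪T (e i), f⟫, so `F s` is T followed by projection onto the span of
  -- the e i with i ∈ s; the error is controlled by the tail of the sum.
  let F : Finset ι → E →L[ℝ] E := fun s =>
    ∑ i ∈ s, (innerSL ℝ (T (e i))).smulRight (e i)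
  have hFapp : ∀ s f, F s f = ∑ i ∈ s, inner ℝ (T (e i)) f • e i := by
    intro s f; simp [F]
  have hF : ∀ s, IsCompactOperator (F s) := by
    intro s
    have : F s ∈ compactOperator (RingHom.id ℝ) E E := by
      refine Submodule.sum_mem _ fun i _ => ?_
      change IsCompactOperator _
      exact (isCompactOperator_of_locallyCompactSpace_rng
        ((ContinuousLinearMap.id ℝ ℝ).smulRight (e i))).comp_clm (innerSL ℝ (T (e i)))
    exact this
  refine isCompactOperator_of_tendsto (l := atTop) (F := F) ?_ (Eventually.of_forall hF)
  rw [tendsto_iff_norm_sub_tendsto_zero]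
  have hbound : ∀ s, ‖F s - T‖ ≤ √(∑' i : {i // i ∉ s}, ‖T (e i)‖ ^ 2) := by
    intro s
    refine ContinuousLinearMap.opNorm_le_bound _ (Real.sqrt_nonneg _) fun f => ?_
    have hinner : ∀ i, inner ℝ (e i) ((F s - T) f)
        = (if i ∈ s then 0 else - inner ℝ (T (e i)) f) := by
      intro i
      have h1 : inner ℝ (e i) (T f) = inner ℝ (T (e i)) f := (hT (e i) f).symm
      rw [_root_.sub_apply, inner_sub_right, h1, hFapp, inner_sum]
      simp only [inner_smul_right, orthonormal_iff_ite.1 e.orthonormal]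
      by_cases hi : i ∈ s <;> simp [hi]
    have hpars : HasSum (fun i => inner ℝ (e i) ((F s - T) f) ^ 2) (‖(F s - T) f‖ ^ 2) := by
      have := e.hasSum_inner_mul_inner ((F s - T) f) ((F s - T) f)
      rw [real_inner_self_eq_norm_sq] at this
      refine this.congr_fun ?_ |> fun h => h
      intro i
      rw [real_inner_comm ((F s - T) f)]; ring
    have hle : ‖(F s - T) f‖ ^ 2 ≤ (∑' i : {i // i ∉ s}, ‖T (e i)‖ ^ 2) * ‖f‖ ^ 2 := by
      have h2 : Summable fun i : {i // i ∉ s} => ‖T (e i)‖ ^ 2 := hsum.subtype _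
      have h3 : HasSum (indicator {i | i ∉ s} fun i => ‖T (e i)‖ ^ 2)
          (∑' i : {i // i ∉ s}, ‖T (e i)‖ ^ 2) :=
        (hasSum_subtype_iff_indicator (s := {i | i ∉ s})).1 h2.hasSum
      refine hasSum_le ?_ hpars (h3.mul_right _)
      intro i
      simp only [hinner]
      by_cases hi : i ∈ s
      · simp [hi]
      · simp only [hi, if_false, neg_sq, indicator, mem_ofPred_eq, not_false_eq_true, if_true]
        rw [← mul_pow, ← sq_abs]
        exact pow_le_pow_left₀ (abs_nonneg _) (abs_real_inner_le_norm _ _) 2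
    calc ‖(F s - T) f‖ = √(‖(F s - T) f‖ ^ 2) := (Real.sqrt_sq (norm_nonneg _)).symm
      _ ≤ √((∑' i : {i // i ∉ s}, ‖T (e i)‖ ^ 2) * ‖f‖ ^ 2) := Real.sqrt_le_sqrt hle
      _ = _ := by rw [Real.sqrt_mul' _ (sq_nonneg _), Real.sqrt_sq (norm_nonneg _)]
  have hlim := (tendsto_tsum_compl_atTop_zero fun i => ‖T (e i)‖ ^ 2).sqrt
  rw [Real.sqrt_zero] at hlim
  exact squeeze_zero (fun _ => norm_nonneg _) hbound hlim

/-- A nonzero compact symmetric operator has a unit eigenvector whose eigenvalue has modulus equal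
to the norm of the operator. -/
theorem ContinuousLinearMap.exists_eigenvector_abs_eq_norm (T : E →L[ℝ] E) (hT : T.IsSymmetric)
    (hc : IsCompactOperator T) (h0 : T ≠ 0) :
    ∃ (lam : ℝ) (v : E), |lam| = ‖T‖ ∧ ‖v‖ = 1 ∧ T v = lam • v := by
  have hr := T.spectralRadius_eq_nnnorm hT.isSelfAdjoint
  -- Over ℝ the spectrum could a priori be empty, but then the spectral radius, which equals ‖T‖,
  -- would be 0.
  have hne : (spectrum ℝ T).Nonempty := by
    by_contra h
    rw [not_nonempty_iff_eq_empty] at h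
    rw [spectralRadius, h] at hr
    simp only [mem_empty_iff_false, iSup_false, bot_eq_zero',
      iSup_const] at hr
    exact h0 (nnnorm_eq_zero.1 (ENNReal.coe_eq_zero.1 hr.symm))
  obtain ⟨lam, hlam, hnorm⟩ := spectrum.exists_nnnorm_eq_spectralRadius_of_nonempty hne
  rw [hr, ENNReal.coe_inj] at hnorm
  have habs : |lam| = ‖T‖ := by simpa using congrArg NNReal.toReal hnorm
  have hlam0 : lam ≠ 0 := by
    rintro rfl
    rw [abs_zero] at habs
    exact h0 (norm_eq_zero.1 habs.symm)
  obtain ⟨v, hv⟩ := ((hc.hasEigenvalue_iff_mem_spectrum hlam0).2 hlam).exists_hasEigenvector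
  have hTv : T v = lam • v := hv.apply_eq_smul
  have hv0 : ‖v‖ ≠ 0 := norm_ne_zero_iff.2 hv.2
  refine ⟨lam, ‖v‖⁻¹ • v, habs, ?_, ?_⟩
  · rw [norm_smul, norm_inv, norm_norm, inv_mul_cancel₀ hv0]
  · rw [map_smul, hTv, smul_comm]

end CompactSymmetric

/-! ### The Airy function: contour shift, decay, positivity -/

noncomputable section

/-- The entire function `z ↦ exp (i (z³/3 + x z))` whose real part on the real line is the
integrand of the Airy integral. -/
def airyPhase (x : ℝ) (z : ℂ) : ℂ :=
  Complex.exp (Complex.I * (z ^ 3 / 3 + x * z))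

theorem continuous_airyPhase (x : ℝ) : Continuous (airyPhase x) := by
  unfold airyPhase; fun_prop

theorem norm_airyPhase (x t η : ℝ) :
    ‖airyPhase x (t + η * Complex.I)‖ = Real.exp (η ^ 3 / 3 - x * η) * Real.exp (-η * t ^ 2) := by
  have h : Complex.I * (((t : ℂ) + η * Complex.I) ^ 3 / 3 + x * (t + η * Complex.I))
      = ((η ^ 3 / 3 - x * η + -η * t ^ 2 : ℝ) : ℂ)
        + ((t ^ 3 / 3 - t * η ^ 2 + x * t : ℝ) : ℂ) * Complex.I := by
    push_cast
    linear_combination (t ^ 2 * η + t * η ^ 2 * Complex.I + η ^ 3 / 3 * (Complex.I ^ 2 - 1)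
      + x * η : ℂ) * Complex.I_sq
  rw [airyPhase, h, Complex.norm_exp, ← Real.exp_add, Complex.add_re, Complex.ofReal_re,
    Complex.re_ofReal_mul, Complex.I_re, mul_zero, add_zero]

theorem integrable_airyPhase (x : ℝ) {η : ℝ} (hη : 0 < η) :
    Integrable fun t : ℝ => airyPhase x (t + η * Complex.I) := by
  have hc : Continuous fun t : ℝ => airyPhase x (t + η * Complex.I) :=
    (continuous_airyPhase x).comp (by fun_prop)
  refine Integrable.mono' ((integrable_exp_neg_mul_sq hη).const_mul (Real.exp (η ^ 3 / 3 - x * η)))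
    hc.aestronglyMeasurable (Eventually.of_forall fun t => (norm_airyPhase x t η).le)

theorem intervalIntegral_airyPhase (x R : ℝ) :
    ∫ t in (-R)..R, airyPhase x t
      = ((2 * ∫ t in (0 : ℝ)..R, Real.cos (t ^ 3 / 3 + x * t) : ℝ) : ℂ) := by
  have hc : Continuous fun t : ℝ => airyPhase x t :=
    (continuous_airyPhase x).comp Complex.continuous_ofReal
  have hc' : Continuous fun t : ℝ => airyPhase x ((-t : ℝ) : ℂ) := hc.comp continuous_neg
  have h1 : ∫ t in (-R)..0, airyPhase x t = ∫ t in (0 : ℝ)..R, airyPhase x ((-t : ℝ) : ℂ) := by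
    rw [intervalIntegral.integral_comp_neg fun t : ℝ => airyPhase x t, neg_zero]
  rw [← intervalIntegral.integral_add_adjacent_intervals (hc.intervalIntegrable _ 0)
    (hc.intervalIntegrable 0 _), h1, ← intervalIntegral.integral_add (hc'.intervalIntegrable _ _)
    (hc.intervalIntegrable _ _), Complex.ofReal_mul, ← intervalIntegral.integral_ofReal,
    ← intervalIntegral.integral_const_mul]
  congr 1
  ext t
  rw [Complex.ofReal_cos, Complex.ofReal_ofNat, Complex.two_cos, airyPhase, airyPhase, add_comm]
  congr 2 <;> push_cast <;> ring

/-- The integrand is at most exp(y³/3 - xy) exp(-yR²). The decay is not uniform near y = 0, hence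
dominated convergence. The function u covers both vertical sides, u = R and u = -R. -/
theorem tendsto_integral_airyPhase_vertical (x : ℝ) {η : ℝ} (hη : 0 < η) {u : ℝ → ℝ}
    (hu : ∀ R, u R ^ 2 = R ^ 2) :
    Tendsto (fun R : ℝ => ∫ y in (0 : ℝ)..η, airyPhase x (u R + y * Complex.I)) atTop (𝓝 0) := by
  have h0 : (0 : ℂ) = ∫ y in (0 : ℝ)..η, (0 : ℂ) := by simp
  rw [h0]
  refine intervalIntegral.tendsto_integral_filter_of_dominated_convergence
    (fun y => Real.exp (y ^ 3 / 3 - x * y)) ?_ ?_ ?_ ?_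
  · refine Eventually.of_forall fun R => ?_
    have : Continuous fun y : ℝ => airyPhase x (u R + y * Complex.I) :=
      (continuous_airyPhase x).comp (by fun_prop)
    exact this.aestronglyMeasurable
  · refine Eventually.of_forall fun R => Eventually.of_forall fun y hy => ?_
    rw [uIoc_of_le hη.le] at hy
    rw [norm_airyPhase]
    refine mul_le_of_le_one_right (Real.exp_pos _).le (Real.exp_le_one_iff.2 ?_)
    have := mul_nonneg hy.1.le (sq_nonneg (u R))
    linarith
  · exact (by fun_prop : Continuous fun y : ℝ => Real.exp (y ^ 3 / 3 - x * y)).intervalIntegrable _ _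
  · refine Eventually.of_forall fun y hy => ?_
    rw [uIoc_of_le hη.le] at hy
    rw [tendsto_zero_iff_norm_tendsto_zero]
    simp_rw [norm_airyPhase, hu]
    have h : Tendsto (fun R : ℝ => y * R ^ 2) atTop atTop :=
      (tendsto_pow_atTop two_ne_zero).const_mul_atTop hy.1
    have h2 := (Real.tendsto_exp_neg_atTop_nhds_zero.comp h).const_mul
      (Real.exp (y ^ 3 / 3 - x * y))
    rw [mul_zero] at h2
    refine h2.congr fun R => ?_
    simp

/-- Cauchy's theorem on the rectangle [-R,R] × [0,η], whose vertical sides vanish in the limit. -/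
theorem tendsto_intervalIntegral_airyPhase (x : ℝ) {η : ℝ} (hη : 0 < η) :
    Tendsto (fun R : ℝ => ∫ t in (-R)..R, airyPhase x t) atTop
      (𝓝 (∫ t : ℝ, airyPhase x (t + η * Complex.I))) := by
  have hd : Differentiable ℂ (airyPhase x) := by unfold airyPhase; fun_prop
  have hrect : ∀ R : ℝ, ∫ t in (-R)..R, airyPhase x t
      = (∫ t in (-R)..R, airyPhase x (t + η * Complex.I))
        - Complex.I • (∫ y in (0 : ℝ)..η, airyPhase x (R + y * Complex.I))
        + Complex.I • ∫ y in (0 : ℝ)..η, airyPhase x ((-R : ℝ) + y * Complex.I) := by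
    intro R
    have h := Complex.integral_boundary_rect_eq_zero_of_differentiableOn (airyPhase x)
      ((-R : ℝ) : ℂ) ((R : ℂ) + η * Complex.I) hd.differentiableOn
    simp only [Complex.ofReal_re, Complex.ofReal_im, Complex.add_re, Complex.add_im,
      Complex.mul_re, Complex.mul_im, Complex.I_re, Complex.I_im, mul_zero, mul_one, zero_mul,
      sub_zero, add_zero, zero_add, Complex.ofReal_zero] at h
    linear_combination h
  have htop := intervalIntegral_tendsto_integral (integrable_airyPhase x hη)
    tendsto_neg_atTop_atBot tendsto_id
  have hr := (tendsto_integral_airyPhase_vertical x hη (u := fun R => R) fun _ => rfl).const_smul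
    Complex.I
  have hl := (tendsto_integral_airyPhase_vertical x hη (u := fun R => -R)
    fun R => neg_sq R).const_smul Complex.I
  have := (htop.sub hr).add hl
  simp only [smul_zero, sub_zero, add_zero] at this
  exact this.congr fun R => (hrect R).symm

/-- The Airy function as an absolutely convergent integral over a line in the upper half plane. -/
theorem airyAi_eq_integral (x : ℝ) {η : ℝ} (hη : 0 < η) :
    (airyAi x : ℂ) = (1 / (2 * Real.pi) : ℝ) * ∫ t : ℝ, airyPhase x (t + η * Complex.I) := by
  set c : ℂ := (1 / (2 * Real.pi) : ℝ) * ∫ t : ℝ, airyPhase x (t + η * Complex.I) with hc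
  have h1 : Tendsto (fun R : ℝ =>
      (((1 / Real.pi) * ∫ t in (0 : ℝ)..R, Real.cos (t ^ 3 / 3 + x * t) : ℝ) : ℂ)) atTop (𝓝 c) := by
    refine ((tendsto_intervalIntegral_airyPhase x hη).const_mul
      ((1 / (2 * Real.pi) : ℝ) : ℂ)).congr fun R => ?_
    rw [intervalIntegral_airyPhase, ← Complex.ofReal_mul]
    congr 1
    field_simp
  have h2 : Tendsto (fun R : ℝ =>
      (1 / Real.pi) * ∫ t in (0 : ℝ)..R, Real.cos (t ^ 3 / 3 + x * t)) atTop (𝓝 c.re) := by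
    have := (Complex.continuous_re.tendsto c).comp h1
    simpa only [Function.comp_def, Complex.ofReal_re] using this
  have h3 : airyAi x = c.re := h2.limUnder_eq
  rw [h3]
  exact tendsto_nhds_unique ((Complex.continuous_ofReal.tendsto _).comp h2) h1

theorem abs_airyAi_le (x : ℝ) {η : ℝ} (hη : 0 < η) :
    |airyAi x| ≤ 1 / (2 * Real.pi) * √(Real.pi / η) * Real.exp (η ^ 3 / 3 - x * η) := by
  have h : |airyAi x| = ‖(airyAi x : ℂ)‖ := by simp
  rw [h, airyAi_eq_integral x hη, norm_mul, Complex.norm_real, Real.norm_of_nonneg (by positivity),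
    mul_assoc]
  gcongr
  refine (norm_integral_le_integral_norm _).trans_eq ?_
  simp_rw [norm_airyPhase]
  rw [integral_const_mul, integral_gaussian, mul_comm]

/-- The Airy function decays at least exponentially at `+∞`. -/
theorem abs_airyAi_le_exp_neg (x : ℝ) : |airyAi x| ≤ Real.exp (-x) := by
  refine (abs_airyAi_le x one_pos).trans ?_
  have h1 : 1 / (2 * Real.pi) * √(Real.pi / 1) ≤ 1 / 3 := by
    have hpi := Real.pi_gt_three
    have hs : √Real.pi ≤ 2 := by
      rw [Real.sqrt_le_left (by norm_num)]; linarith [Real.pi_lt_four]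
    rw [div_one, div_mul_eq_mul_div, one_mul, div_le_iff₀ (by positivity)]
    linarith
  have h2 : Real.exp (1 ^ 3 / 3 - x * 1) = Real.exp (1 / 3) * Real.exp (-x) := by
    rw [← Real.exp_add]; congr 1; ring
  have h3 : Real.exp (1 / 3) ≤ 3 :=
    (Real.exp_le_exp.2 (by norm_num)).trans Real.exp_one_lt_three.le
  rw [h2, ← mul_assoc]
  refine mul_le_of_le_one_left (Real.exp_pos _).le ?_
  calc 1 / (2 * Real.pi) * √(Real.pi / 1) * Real.exp (1 / 3) ≤ 1 / 3 * 3 := by gcongr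
    _ = 1 := by norm_num

theorem continuous_airyAi : Continuous airyAi := by
  have h : airyAi = fun x =>
      ((1 / (2 * Real.pi) : ℝ) * ∫ t : ℝ, airyPhase x (t + (1 : ℝ) * Complex.I) : ℂ).re := by
    ext x
    rw [← airyAi_eq_integral x one_pos, Complex.ofReal_re]
  rw [h]
  refine Complex.continuous_re.comp (continuous_const.mul ?_)
  refine continuous_iff_continuousAt.2 fun x₀ => ?_
  refine continuousAt_of_dominated
    (bound := fun t => Real.exp (1 ^ 3 / 3 - (x₀ - 1) * 1) * Real.exp (-1 * t ^ 2)) ?_ ?_ ?_ ?_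
  · exact Eventually.of_forall fun x => (integrable_airyPhase x one_pos).aestronglyMeasurable
  · filter_upwards [lt_mem_nhds (sub_one_lt x₀)] with x hx
    refine Eventually.of_forall fun t => ?_
    rw [norm_airyPhase]
    gcongr
  · exact (integrable_exp_neg_mul_sq one_pos).const_mul _
  · refine Eventually.of_forall fun t => ?_
    unfold airyPhase
    fun_prop

/-- A shifted Airy function with an exponential weight is an inverse Fourier integral with a
Gaussian factor. -/
theorem exp_mul_airyAi_eq_integral (x : ℝ) {η : ℝ} (hη : 0 < η) :
    ((Real.exp (η * x + 2 * η ^ 3 / 3) * airyAi (x + η ^ 2) : ℝ) : ℂ)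
      = (1 / (2 * Real.pi) : ℝ) *
        ∫ t : ℝ, Complex.exp (Complex.I * (t ^ 3 / 3 + x * t) - η * t ^ 2) := by
  -- The shift of x by η² cancels the term -tη² coming from (t + iη)³/3, and the prefactor cancels
  -- the constant -ηx - 2η³/3.
  rw [Complex.ofReal_mul, airyAi_eq_integral _ hη, mul_left_comm, ← integral_const_mul]
  congr 2
  ext t
  rw [airyPhase, Complex.ofReal_exp, ← Complex.exp_add]
  congr 1
  push_cast
  linear_combination (t ^ 2 * η + t * η ^ 2 * Complex.I + η ^ 3 / 3 * (Complex.I ^ 2 - 1)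
      + (x + η ^ 2) * η : ℂ) * Complex.I_sq

/-- From cos u ≥ 1 - u²/2 the loss is t⁶ exp(-ηt²)/18, at most exp(-ηt²/2)/3 because t⁶ exp(-ηt²/2)
≤ 6 when η ≥ 2. The loss integrates to at most √2/3 times the integral of exp(-ηt²). -/
theorem integral_cos_cube_mul_exp_pos {η : ℝ} (hη : 2 ≤ η) :
    0 < ∫ t : ℝ, Real.cos (t ^ 3 / 3) * Real.exp (-η * t ^ 2) := by
  have hη0 : 0 < η := by linarith
  have hle : ∀ t : ℝ, Real.exp (-η * t ^ 2) - 1 / 3 * Real.exp (-(η / 2) * t ^ 2)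
      ≤ Real.cos (t ^ 3 / 3) * Real.exp (-η * t ^ 2) := by
    intro t
    have hs : 0 ≤ η / 2 * t ^ 2 := by positivity
    have h1 : (η / 2 * t ^ 2) ^ 3 * Real.exp (-(η / 2) * t ^ 2) ≤ 6 := by
      have h := Real.pow_div_factorial_le_exp _ hs 3
      have h6 : ((Nat.factorial 3 : ℕ) : ℝ) = 6 := by norm_num [Nat.factorial]
      rw [h6, div_le_iff₀ (by norm_num)] at h
      calc _ ≤ Real.exp (η / 2 * t ^ 2) * 6 * Real.exp (-(η / 2) * t ^ 2) := by gcongr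
        _ = 6 * (Real.exp (η / 2 * t ^ 2) * Real.exp (-(η / 2) * t ^ 2)) := by ring
        _ = 6 := by rw [← Real.exp_add]; simp
    have h2 : t ^ 6 ≤ (η / 2 * t ^ 2) ^ 3 := by
      have : (1 : ℝ) ≤ (η / 2) ^ 3 := one_le_pow₀ (by linarith)
      calc t ^ 6 = 1 * t ^ 6 := (one_mul _).symm
        _ ≤ (η / 2) ^ 3 * t ^ 6 := by gcongr
        _ = _ := by ring
    have h3 := Real.one_sub_sq_div_two_le_cos (x := t ^ 3 / 3)
    have h4 : Real.exp (-η * t ^ 2)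
        = Real.exp (-(η / 2) * t ^ 2) * Real.exp (-(η / 2) * t ^ 2) := by
      rw [← Real.exp_add]; congr 1; ring
    have h5 : t ^ 6 * Real.exp (-η * t ^ 2) ≤ 6 * Real.exp (-(η / 2) * t ^ 2) := by
      rw [h4, ← mul_assoc]
      gcongr
      exact (mul_le_mul_of_nonneg_right h2 (Real.exp_pos _).le).trans h1
    have h6 := mul_le_mul_of_nonneg_right h3 (Real.exp_pos (-η * t ^ 2)).le
    nlinarith [h5, h6]
  have hi1 : Integrable fun t : ℝ => Real.exp (-η * t ^ 2) := integrable_exp_neg_mul_sq hη0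
  have hi2 : Integrable fun t : ℝ => 1 / 3 * Real.exp (-(η / 2) * t ^ 2) :=
    (integrable_exp_neg_mul_sq (half_pos hη0)).const_mul _
  have hi3 : Integrable fun t : ℝ => Real.cos (t ^ 3 / 3) * Real.exp (-η * t ^ 2) := by
    refine hi1.mono' (by fun_prop) (Eventually.of_forall fun t => ?_)
    rw [norm_mul, Real.norm_eq_abs, Real.norm_of_nonneg (Real.exp_pos _).le]
    exact mul_le_of_le_one_left (Real.exp_pos _).le (Real.abs_cos_le_one _)
  refine lt_of_lt_of_le ?_ (integral_mono (hi1.sub hi2) hi3 hle)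
  simp only [Pi.sub_apply]
  rw [integral_sub hi1 hi2, integral_const_mul, integral_gaussian, integral_gaussian]
  have h : √(Real.pi / (η / 2)) = √2 * √(Real.pi / η) := by
    rw [← Real.sqrt_mul (by norm_num)]; congr 1; field_simp
  have h2 : √2 ≤ 2 := by rw [Real.sqrt_le_left (by norm_num)]; norm_num
  have h3 : 0 < √(Real.pi / η) := by positivity
  rw [h]
  nlinarith

/-- The height η = √x puts the contour through the saddle point i√x, where the linear term of the
phase disappears; x ≥ 4 gives η ≥ 2. -/
theorem airyAi_pos {x : ℝ} (hx : 4 ≤ x) : 0 < airyAi x := by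
  have hη : 2 ≤ √x := Real.le_sqrt_of_sq_le (by linarith)
  have hη0 : 0 < √x := by linarith
  have h := congrArg Complex.re (exp_mul_airyAi_eq_integral 0 hη0)
  have hexp : ∀ t : ℝ, Complex.I * (t ^ 3 / 3 + (0 : ℝ) * t) - √x * t ^ 2
      = ((-√x * t ^ 2 : ℝ) : ℂ) + ((t ^ 3 / 3 : ℝ) : ℂ) * Complex.I := by
    intro t; push_cast; ring
  have hint : Integrable fun t : ℝ =>
      Complex.exp (Complex.I * (t ^ 3 / 3 + (0 : ℝ) * t) - √x * t ^ 2) := by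
    refine (integrable_exp_neg_mul_sq hη0).mono' (by fun_prop) (Eventually.of_forall fun t => ?_)
    rw [Complex.norm_exp, hexp, Complex.add_re, Complex.ofReal_re, Complex.re_ofReal_mul,
      Complex.I_re, mul_zero, add_zero]
  rw [Complex.ofReal_re, Complex.re_ofReal_mul, zero_add, Real.sq_sqrt (by linarith)] at h
  rw [← Complex.reCLM_apply, ← ContinuousLinearMap.integral_comp_comm _ hint] at h
  have h2 : ∀ t : ℝ, Complex.reCLM
      (Complex.exp (Complex.I * (t ^ 3 / 3 + (0 : ℝ) * t) - √x * t ^ 2))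
      = Real.cos (t ^ 3 / 3) * Real.exp (-√x * t ^ 2) := by
    intro t
    rw [Complex.reCLM_apply, hexp, Complex.exp_add, ← Complex.ofReal_exp, Complex.re_ofReal_mul,
      Complex.exp_ofReal_mul_I_re, mul_comm]
  simp_rw [h2] at h
  have h3 : 0 < Real.exp (√x * 0 + 2 * √x ^ 3 / 3) * airyAi x := by
    rw [h]
    exact mul_pos (by positivity) (integral_cos_cube_mul_exp_pos hη)
  exact pos_of_mul_pos_right h3 (Real.exp_pos _).le

end

/-! ### Parseval's identity for the Airy transform -/

noncomputable section

open FourierTransform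

/-- Dominated convergence to zero in `L²`. -/
theorem tendsto_eLpNorm_two_of_dominated {α E F : Type*} [MeasurableSpace α] {μ : Measure α}
    [NormedAddCommGroup E] [NormedAddCommGroup F] {u : ℕ → α → E} {h : α → F}
    (hu : ∀ n, AEStronglyMeasurable (u n) μ) (hh : MemLp h 2 μ)
    (hle : ∀ n, ∀ᵐ x ∂μ, ‖u n x‖ ≤ ‖h x‖)
    (hlim : ∀ᵐ x ∂μ, Tendsto (fun n => u n x) atTop (𝓝 0)) :
    Tendsto (fun n => eLpNorm (u n) 2 μ) atTop (𝓝 0) := by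
  have h1 : Tendsto (fun n => ∫⁻ x, ‖u n x‖ₑ ^ (2 : ℝ) ∂μ) atTop (𝓝 (∫⁻ _, 0 ∂μ)) := by
    refine tendsto_lintegral_of_dominated_convergence' (fun x => ‖h x‖ₑ ^ (2 : ℝ))
      (fun n => (hu n).enorm.pow_const _) (fun n => ?_) ?_ ?_
    · filter_upwards [hle n] with x hx
      gcongr
      exact enorm_le_iff_norm_le.2 hx
    · have := lintegral_rpow_enorm_lt_top_of_eLpNorm_lt_top (p := 2) (by norm_num) (by norm_num) hh.2
      simpa using this.ne
    · filter_upwards [hlim] with x hx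
      have h2 := (continuous_enorm.tendsto (0 : E)).comp hx
      rw [enorm_zero] at h2
      have h3 := (ENNReal.continuous_rpow_const (y := 2)).tendsto (0 : ENNReal) |>.comp h2
      simpa [Function.comp_def] using h3
  rw [lintegral_zero] at h1
  have h2 := (ENNReal.continuous_rpow_const (y := 1 / 2)).tendsto (0 : ENNReal) |>.comp h1
  rw [ENNReal.zero_rpow_of_pos (by norm_num)] at h2
  refine h2.congr fun n => ?_
  rw [eLpNorm_eq_lintegral_rpow_enorm_toReal (by norm_num) (by norm_num)]
  simp

/-- The Fourier multiplier of the Airy transform, with a Gaussian damping factor. -/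
def airyMultiplier (η s : ℝ) : ℂ :=
  Complex.exp (Complex.I * ((2 * Real.pi * s) ^ 3 / 3) - η * (2 * Real.pi * s) ^ 2)

theorem continuous_airyMultiplier (η : ℝ) : Continuous (airyMultiplier η) := by
  unfold airyMultiplier; fun_prop

theorem norm_airyMultiplier (η s : ℝ) :
    ‖airyMultiplier η s‖ = Real.exp (-η * (2 * Real.pi * s) ^ 2) := by
  have h : Complex.I * ((2 * Real.pi * s : ℂ) ^ 3 / 3) - η * (2 * Real.pi * s) ^ 2
      = ((-η * (2 * Real.pi * s) ^ 2 : ℝ) : ℂ)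
        + (((2 * Real.pi * s) ^ 3 / 3 : ℝ) : ℂ) * Complex.I := by
    push_cast; ring
  rw [airyMultiplier, h, Complex.norm_exp, Complex.add_re, Complex.ofReal_re,
    Complex.re_ofReal_mul, Complex.I_re, mul_zero, add_zero]

theorem norm_airyMultiplier_le_one {η : ℝ} (hη : 0 ≤ η) (s : ℝ) : ‖airyMultiplier η s‖ ≤ 1 := by
  rw [norm_airyMultiplier, Real.exp_le_one_iff, neg_mul, neg_nonpos]
  positivity

theorem integrable_airyMultiplier {η : ℝ} (hη : 0 < η) : Integrable (airyMultiplier η) := by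
  have h : 0 < η * (2 * Real.pi) ^ 2 := by positivity
  refine (integrable_exp_neg_mul_sq h).mono' (continuous_airyMultiplier η).aestronglyMeasurable
    (Eventually.of_forall fun s => ?_)
  rw [norm_airyMultiplier]
  refine le_of_eq (congrArg _ ?_)
  ring

/-- The Airy kernel with a Gaussian damping on the Fourier side. -/
def dampedAiry (η x : ℝ) : ℝ := Real.exp (η * x + 2 * η ^ 3 / 3) * airyAi (x + η ^ 2)

theorem continuous_dampedAiry (η : ℝ) : Continuous (dampedAiry η) := by
  have := continuous_airyAi
  unfold dampedAiry
  fun_prop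

theorem dampedAiry_eq_integral (x : ℝ) {η : ℝ} (hη : 0 < η) :
    (dampedAiry η x : ℂ)
      = ∫ s : ℝ, Complex.exp (((2 * Real.pi * (s * x) : ℝ) : ℂ) * Complex.I)
          * airyMultiplier η s := by
  rw [dampedAiry, exp_mul_airyAi_eq_integral x hη]
  have h := Measure.integral_comp_mul_left
    (fun t : ℝ => Complex.exp (Complex.I * (t ^ 3 / 3 + x * t) - η * t ^ 2)) (2 * Real.pi)
  rw [abs_of_pos (by positivity), Complex.real_smul, ← one_div] at h
  rw [← h]
  congr 1
  ext s
  rw [airyMultiplier, ← Complex.exp_add]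
  congr 1
  push_cast
  ring

/-- A bound uniform in η, for dominated convergence as η → 0. It needs x bounded below, which is
where the support of σ in a half-line enters. -/
theorem abs_dampedAiry_le {c x η : ℝ} (hη : 0 < η) (hη1 : η ≤ 1) (hx : c ≤ x) :
    |dampedAiry η x| ≤ Real.exp (2 / 3 + |c|) := by
  rw [dampedAiry, abs_mul, abs_of_pos (Real.exp_pos _)]
  refine (mul_le_mul_of_nonneg_left (abs_airyAi_le_exp_neg _) (Real.exp_pos _).le).trans ?_
  rw [← Real.exp_add, Real.exp_le_exp]
  have h1 : η ^ 3 ≤ 1 := pow_le_one₀ hη.le hη1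
  have h2 : -|c| ≤ x := (neg_abs_le c).trans hx
  have h3 : (1 - η) * -|c| ≤ (1 - η) * x := mul_le_mul_of_nonneg_left h2 (by linarith)
  nlinarith [abs_nonneg c, sq_nonneg η, mul_nonneg hη.le (abs_nonneg c)]

theorem tendsto_dampedAiry (x : ℝ) {η : ℕ → ℝ} (hη : Tendsto η atTop (𝓝 0)) :
    Tendsto (fun n => dampedAiry (η n) x) atTop (𝓝 (airyAi x)) := by
  have hc : Continuous fun η => dampedAiry η x := by
    have := continuous_airyAi
    unfold dampedAiry
    fun_prop
  have h := (hc.tendsto 0).comp hη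
  simpa [dampedAiry, Function.comp_def] using h

/-- The damped Airy transform acts as a Fourier multiplier. -/
theorem integral_dampedAiry_mul_eq_fourierInv {σ : ℝ → ℝ} (hσ : Integrable σ) {η : ℝ} (hη : 0 < η)
    (x : ℝ) : ((∫ y, dampedAiry η (x + y) * σ y : ℝ) : ℂ)
      = 𝓕⁻ (fun s => airyMultiplier η s * 𝓕⁻ (fun y => (σ y : ℂ)) s) x := by
  have hσc : Integrable fun y => (σ y : ℂ) := hσ.ofReal
  rw [← integral_complex_ofReal]
  have h1 : ∀ y, ((dampedAiry η (x + y) * σ y : ℝ) : ℂ)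
      = ∫ s : ℝ, Complex.exp (((2 * Real.pi * (s * (x + y)) : ℝ) : ℂ) * Complex.I)
          * (airyMultiplier η s * σ y) := by
    intro y
    rw [Complex.ofReal_mul, dampedAiry_eq_integral _ hη, ← integral_mul_const]
    simp_rw [mul_assoc]
  simp_rw [h1]
  -- The Gaussian factor makes the multiplier integrable, which permits Fubini.
  have hint : Integrable (Function.uncurry fun (y s : ℝ) =>
      Complex.exp (((2 * Real.pi * (s * (x + y)) : ℝ) : ℂ) * Complex.I)
          * (airyMultiplier η s * σ y)) (volume.prod volume) := by
    have hp : Integrable (fun z : ℝ × ℝ => (σ z.1 : ℂ) * airyMultiplier η z.2)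
        (volume.prod volume) := hσc.mul_prod (integrable_airyMultiplier hη)
    refine hp.mono ?_ (Eventually.of_forall fun z => ?_)
    · refine AEStronglyMeasurable.mul (Continuous.aestronglyMeasurable (by fun_prop)) ?_
      simpa only [mul_comm] using hp.aestronglyMeasurable
    · simp only [Function.uncurry, norm_mul, Complex.norm_exp_ofReal_mul_I, one_mul]
      rw [mul_comm]
  rw [integral_integral_swap hint, Real.fourierInv_eq']
  congr 1
  ext s
  rw [Real.fourierInv_eq', smul_eq_mul, ← integral_const_mul, ← integral_const_mul]
  congr 1
  ext y
  simp only [smul_eq_mul, RCLike.inner_apply, conj_trivial]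
  have : Complex.exp (((2 * Real.pi * (s * (x + y)) : ℝ) : ℂ) * Complex.I)
      = Complex.exp (((2 * Real.pi * (x * s) : ℝ) : ℂ) * Complex.I)
        * Complex.exp (((2 * Real.pi * (s * y) : ℝ) : ℂ) * Complex.I) := by
    rw [← Complex.exp_add]; congr 1; push_cast; ring
  rw [this]
  ring

theorem fourierInv_sub_of_integrable {g h : ℝ → ℂ} (hg : Integrable g) (hh : Integrable h) :
    𝓕⁻ (g - h) = 𝓕⁻ g - 𝓕⁻ h := by
  have hexp : ∀ (x : ℝ) {k : ℝ → ℂ}, Integrable k → Integrable fun v : ℝ =>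
      Complex.exp (((2 * Real.pi * inner ℝ v x : ℝ) : ℂ) * Complex.I) • k v := by
    intro x k hk
    refine hk.mono ?_ (Eventually.of_forall fun v => ?_)
    · have hc : Continuous fun v : ℝ =>
          Complex.exp (((2 * Real.pi * inner ℝ v x : ℝ) : ℂ) * Complex.I) := by fun_prop
      exact hc.aestronglyMeasurable.smul hk.aestronglyMeasurable
    · rw [norm_smul, Complex.norm_exp_ofReal_mul_I, one_mul]
  ext x
  rw [Pi.sub_apply, Real.fourierInv_eq', Real.fourierInv_eq', Real.fourierInv_eq',
    ← integral_sub (hexp x hg) (hexp x hh)]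
  simp_rw [Pi.sub_apply, smul_sub]

theorem airyTransformFrom_eq_integral {a : ℝ} {σ : ℝ → ℝ} (hs : ∀ᵐ y : ℝ, y < a → σ y = 0)
    (x : ℝ) : airyTransformFrom a σ x = ∫ y, airyAi (x + y) * σ y := by
  refine setIntegral_eq_integral_of_ae_compl_eq_zero ?_
  filter_upwards [hs] with y hy hya
  rw [hy (not_le.1 hya), mul_zero]

theorem eLpNorm_complex_ofReal {α : Type*} [MeasurableSpace α] {μ : Measure α} (f : α → ℝ) :
    eLpNorm (fun x => (f x : ℂ)) 2 μ = eLpNorm f 2 μ :=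
  eLpNorm_congr_norm_ae (Eventually.of_forall fun _ => Complex.norm_real _)

/-- The Airy transform of an integrable function in `L²` supported on a half-line is isometric. -/
theorem airyTransformFrom_isometry_of_integrable {a : ℝ} {σ : ℝ → ℝ} (hσ1 : Integrable σ)
    (hσ : MemLp σ 2 volume) (hs : ∀ᵐ y : ℝ, y < a → σ y = 0) :
    MemLp (airyTransformFrom a σ) 2 volume ∧
      eLpNorm (airyTransformFrom a σ) 2 volume = eLpNorm σ 2 volume := by
  set S : ℝ → ℂ := 𝓕⁻ (fun y => (σ y : ℂ)) with hSdef
  have hσc : Integrable fun y => (σ y : ℂ) := hσ1.ofReal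
  have hσc2 : MemLp (fun y => (σ y : ℂ)) 2 volume := hσ.ofReal
  obtain ⟨hS, hSnorm⟩ := hσc2.fourierInv_of_integrable hσc
  have hSb : ∀ s, ‖S s‖ ≤ ∫ y, ‖(σ y : ℂ)‖ := by
    intro s
    rw [hSdef, Real.fourierInv_eq']
    refine (norm_integral_le_integral_norm _).trans_eq ?_
    simp_rw [norm_smul, Complex.norm_exp_ofReal_mul_I, one_mul]
  let η : ℕ → ℝ := fun n => 1 / ((n : ℝ) + 1)
  have hη0 : ∀ n, 0 < η n := fun n => Nat.one_div_pos_of_nat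
  have hη1 : ∀ n, η n ≤ 1 := fun n => by
    simp only [η]
    rw [div_le_one (by positivity)]
    linarith [Nat.cast_nonneg (α := ℝ) n]
  have hηlim : Tendsto η atTop (𝓝 0) := tendsto_one_div_add_atTop_nhds_zero_nat
  let g : ℕ → ℝ → ℂ := fun n s => airyMultiplier (η n) s * S s
  -- Without damping the multiplier is unimodular: `g'` keeps the norm of `S` but need not be
  -- integrable, so Plancherel is applied to `g n` only.
  let g' : ℝ → ℂ := fun s => airyMultiplier 0 s * S s
  have hmul : ∀ {e : ℝ}, 0 ≤ e → MemLp (fun s => airyMultiplier e s * S s) 2 volume := by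
    intro e he
    refine hS.of_le ((continuous_airyMultiplier e).aestronglyMeasurable.mul hS.1)
      (Eventually.of_forall fun s => ?_)
    rw [norm_mul]
    exact mul_le_of_le_one_left (norm_nonneg _) (norm_airyMultiplier_le_one he s)
  have hg1 : ∀ n, Integrable (g n) := fun n =>
    (integrable_airyMultiplier (hη0 n)).mul_bdd hS.1 (Eventually.of_forall hSb)
  have hg : ∀ n, MemLp (g n) 2 volume := fun n => hmul (hη0 n).le
  have hg' : MemLp g' 2 volume := hmul le_rfl
  have hglim : Tendsto (fun n => eLpNorm (g n - g') 2 volume) atTop (𝓝 0) := by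
    refine tendsto_eLpNorm_two_of_dominated (h := fun s => 2 * S s)
      (fun n => (hg n).1.sub hg'.1) (hS.const_mul 2) (fun n => Eventually.of_forall fun s => ?_)
      (Eventually.of_forall fun s => ?_)
    · simp only [g, g', Pi.sub_apply]
      rw [← sub_mul, norm_mul, norm_mul, Complex.norm_ofNat]
      gcongr
      refine (norm_sub_le _ _).trans ?_
      linarith [norm_airyMultiplier_le_one (hη0 n).le s, norm_airyMultiplier_le_one le_rfl s]
    · have hc : Continuous fun e : ℝ => airyMultiplier e s * S s - g' s := by
        unfold airyMultiplier; fun_prop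
      have := (hc.tendsto 0).comp hηlim
      simpa [g', Function.comp_def] using this
  have hlim : ∀ x, Tendsto (fun n => 𝓕⁻ (g n) x) atTop (𝓝 (airyTransformFrom a σ x : ℂ)) := by
    intro x
    have h1 : Tendsto (fun n => ∫ y, dampedAiry (η n) (x + y) * σ y) atTop
        (𝓝 (∫ y, airyAi (x + y) * σ y)) := by
      refine tendsto_integral_of_dominated_convergence
        (fun y => Real.exp (2 / 3 + |x + a|) * ‖σ y‖) (fun n => ?_) (hσ1.norm.const_mul _)
        (fun n => ?_) (Eventually.of_forall fun y => ?_)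
      · exact (((continuous_dampedAiry (η n)).comp
          (continuous_const.add continuous_id)).aestronglyMeasurable).mul hσ1.1
      · filter_upwards [hs] with y hy
        rcases lt_or_ge y a with hya | hya
        · simp [hy hya]
        · rw [norm_mul]
          gcongr
          exact abs_dampedAiry_le (hη0 n) (hη1 n) (by linarith)
      · exact (tendsto_dampedAiry (x + y) hηlim).mul_const _
    rw [airyTransformFrom_eq_integral hs]
    refine ((Complex.continuous_ofReal.tendsto _).comp h1).congr fun n => ?_
    exact integral_dampedAiry_mul_eq_fourierInv hσ1 (hη0 n) x
  have hpl := fun n => (hg n).fourierInv_of_integrable (hg1 n)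
  have key := eLpNorm_eq_of_tendsto_of_isometric (fun n => (hpl n).1.1) hg hg'
    (Eventually.of_forall hlim) hglim (fun n => (hpl n).2) (fun n m => by
      rw [← fourierInv_sub_of_integrable (hg1 n) (hg1 m)]
      exact (((hg n).sub (hg m)).fourierInv_of_integrable ((hg1 n).sub (hg1 m))).2)
  have hg'norm : eLpNorm g' 2 volume = eLpNorm σ 2 volume := by
    rw [← eLpNorm_complex_ofReal σ, ← hSnorm]
    refine eLpNorm_congr_norm_ae (Eventually.of_forall fun s => ?_)
    simp [g', norm_airyMultiplier, hSdef]
  refine ⟨?_, ?_⟩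
  · simpa using key.1.re
  · rw [← eLpNorm_complex_ofReal, key.2, hg'norm]

theorem memLp_exp_neg_Ici (a : ℝ) :
    MemLp (fun y : ℝ => Real.exp (-y)) 2 (volume.restrict (Ici a)) := by
  rw [memLp_two_iff_integrable_sq (by fun_prop)]
  have h : (fun y : ℝ => Real.exp (-y) ^ 2) = fun y => Real.exp (-2 * y) := by
    ext y; rw [← Real.exp_nat_mul]; congr 1; push_cast; ring
  rw [h]
  exact (integrableOn_Ici_iff_integrableOn_Ioi).2 (exp_neg_integrableOn_Ioi a two_pos)

/-- The Airy kernel is square-integrable on half-lines. -/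
theorem memLp_airyAi_add_Ici (a x : ℝ) :
    MemLp (fun y : ℝ => airyAi (x + y)) 2 (volume.restrict (Ici a)) := by
  refine ((memLp_exp_neg_Ici a).const_mul (Real.exp (-x))).of_le
    (continuous_airyAi.comp (continuous_const.add continuous_id)).aestronglyMeasurable
    (Eventually.of_forall fun y => ?_)
  rw [← Real.exp_add, Real.norm_of_nonneg (Real.exp_pos _).le]
  refine (abs_airyAi_le_exp_neg _).trans_eq (congrArg _ (by ring))

theorem integrableOn_airyAi_mul {a : ℝ} {σ : ℝ → ℝ} (hσ : MemLp σ 2 (volume.restrict (Ici a)))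
    (x : ℝ) : IntegrableOn (fun y => airyAi (x + y) * σ y) (Ici a) :=
  (memLp_airyAi_add_Ici a x).integrable_mul hσ

/-- **Parseval's identity** for the Airy transform of an `L²` function supported on a half-line. -/
theorem airyTransformFrom_isometry {a : ℝ} {σ : ℝ → ℝ} (hσ : MemLp σ 2 volume)
    (hs : ∀ᵐ y : ℝ, y < a → σ y = 0) :
    MemLp (airyTransformFrom a σ) 2 volume ∧
      eLpNorm (airyTransformFrom a σ) 2 volume = eLpNorm σ 2 volume := by
  -- Truncation to a bounded interval makes σ integrable, reducing to the previous case.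
  let g : ℕ → ℝ → ℝ := fun n => (Icc a n).indicator σ
  have hg : ∀ n, MemLp (g n) 2 volume := fun n => hσ.indicator measurableSet_Icc
  have hg1 : ∀ n, Integrable (g n) := fun n => by
    have h : IntegrableOn σ (Icc a n) volume :=
      (hσ.restrict (Icc a n)).integrable (by norm_num)
    exact h.integrable_indicator measurableSet_Icc
  have hgs : ∀ n, ∀ y, y < a → g n y = 0 := fun n y hy =>
    indicator_of_notMem (fun h => absurd h.1 (not_le.2 hy)) _
  have hgle : ∀ n y, ‖g n y‖ ≤ ‖σ y‖ := fun n y => norm_indicator_le_norm_self _ _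
  have hgev : ∀ y, (y < a → σ y = 0) → ∀ᶠ n in atTop, g n y = σ y := by
    intro y hy
    filter_upwards [eventually_ge_atTop ⌈y⌉₊] with n hn
    rcases lt_or_ge y a with hya | hya
    · rw [hgs n y hya, hy hya]
    · exact indicator_of_mem (mem_Icc.2 ⟨hya, Nat.ceil_le.1 hn⟩) _
  have hglim : Tendsto (fun n => eLpNorm (g n - σ) 2 volume) atTop (𝓝 0) := by
    refine tendsto_eLpNorm_two_of_dominated (h := fun y => 2 * σ y)
      (fun n => (hg n).1.sub hσ.1) (hσ.const_mul 2) (fun n => Eventually.of_forall fun y => ?_) ?_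
    · rw [Pi.sub_apply, norm_mul, Real.norm_ofNat]
      linarith [norm_sub_le (g n y) (σ y), hgle n y]
    · filter_upwards [hs] with y hy
      refine tendsto_const_nhds.congr' ?_
      filter_upwards [hgev y hy] with n hn
      rw [Pi.sub_apply, hn, sub_self]
  have hlim : ∀ x, Tendsto (fun n => airyTransformFrom a (g n) x) atTop
      (𝓝 (airyTransformFrom a σ x)) := by
    intro x
    refine tendsto_integral_of_dominated_convergence (fun y => ‖airyAi (x + y) * σ y‖)
      (fun n => (integrableOn_airyAi_mul ((hg n).restrict _) x).aestronglyMeasurable)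
      (integrableOn_airyAi_mul (hσ.restrict _) x).norm
      (fun n => Eventually.of_forall fun y => ?_) ?_
    · rw [norm_mul, norm_mul]
      gcongr
      exact hgle n y
    · filter_upwards [ae_restrict_of_ae hs] with y hy
      refine tendsto_const_nhds.congr' ?_
      filter_upwards [hgev y hy] with n hn
      rw [hn]
  have hiso := fun n => airyTransformFrom_isometry_of_integrable (hg1 n) (hg n)
    (Eventually.of_forall (hgs n))
  refine eLpNorm_eq_of_tendsto_of_isometric (fun n => (hiso n).1.1) hg hσ
    (Eventually.of_forall hlim) hglim (fun n => (hiso n).2) (fun n m => ?_)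
  have hsub : airyTransformFrom a (g n) - airyTransformFrom a (g m)
      = airyTransformFrom a (g n - g m) := by
    ext x
    simp only [airyTransformFrom, Pi.sub_apply, mul_sub]
    exact (integral_sub (integrableOn_airyAi_mul ((hg n).restrict _) x)
      (integrableOn_airyAi_mul ((hg m).restrict _) x)).symm
  rw [hsub]
  exact (airyTransformFrom_isometry_of_integrable ((hg1 n).sub (hg1 m)) ((hg n).sub (hg m))
    (Eventually.of_forall fun y hy => by rw [Pi.sub_apply, hgs n y hy, hgs m y hy, sub_self])).2

theorem MeasureTheory.MemLp.integral_sq_eq_toReal_eLpNorm_sq {α : Type*} [MeasurableSpace α]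
    {μ : Measure α} {f : α → ℝ} (hf : MemLp f 2 μ) :
    ∫ x, f x ^ 2 ∂μ = (eLpNorm f 2 μ).toReal ^ 2 := by
  have h1 := hf.eLpNorm_eq_integral_rpow_norm (by norm_num) (by norm_num)
  have h2 : 0 ≤ ∫ x, f x ^ 2 ∂μ := integral_nonneg fun x => sq_nonneg _
  rw [h1, ENNReal.toReal_ofReal (by positivity)]
  simp only [ENNReal.toReal_ofNat, Real.rpow_ofNat, Real.norm_eq_abs, sq_abs]
  rw [← Real.rpow_natCast, ← Real.rpow_mul h2]
  norm_num

/-- Integral form of Parseval's identity for the Airy transform. -/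
theorem integral_airyTransformFrom_sq {a : ℝ} {σ : ℝ → ℝ} (hσ : MemLp σ 2 volume)
    (hs : ∀ᵐ y : ℝ, y < a → σ y = 0) :
    ∫ x, airyTransformFrom a σ x ^ 2 = ∫ y, σ y ^ 2 := by
  obtain ⟨h1, h2⟩ := airyTransformFrom_isometry hσ hs
  rw [h1.integral_sq_eq_toReal_eLpNorm_sq, hσ.integral_sq_eq_toReal_eLpNorm_sq, h2]

end

/-! ### Integral operators with dominated kernels -/

noncomputable section

section KernelOperator

variable {α : Type*} [MeasurableSpace α]

/-- A symmetric measurable kernel dominated by `w ⊗ w` for a square-integrable function `w`. -/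
structure IsDominatedKernel (μ : Measure α) (k : α → α → ℝ) (w : α → ℝ) : Prop where
  stronglyMeasurable : StronglyMeasurable (Function.uncurry k)
  memLp : MemLp w 2 μ
  nonneg : ∀ x, 0 ≤ w x
  symm : ∀ x y, k x y = k y x
  bound : ∀ x y, |k x y| ≤ w x * w y

namespace IsDominatedKernel

variable {μ : Measure α} {k : α → α → ℝ} {w : α → ℝ}

theorem memLp_row (h : IsDominatedKernel μ k w) (x : α) : MemLp (k x) 2 μ := by
  refine (h.memLp.const_mul (w x)).of_le
    (h.stronglyMeasurable.comp_measurable measurable_prodMk_left).aestronglyMeasurable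
    (Eventually.of_forall fun y => ?_)
  rw [Real.norm_of_nonneg (mul_nonneg (h.nonneg x) (h.nonneg y))]
  exact h.bound x y

theorem norm_toLp_row_le (h : IsDominatedKernel μ k w) (x : α) :
    ‖(h.memLp_row x).toLp (k x)‖ ≤ w x * ‖h.memLp.toLp w‖ := by
  refine Lp.norm_le_mul_norm_of_ae_le_mul ?_
  filter_upwards [(h.memLp_row x).coeFn_toLp, h.memLp.coeFn_toLp] with y hy hw
  rw [hy, hw, Real.norm_of_nonneg (h.nonneg y)]
  exact h.bound x y

/-- Through this form, linearity, Cauchy–Schwarz and Bessel's inequality become available for the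
integral operator. -/
theorem integral_eq_inner (h : IsDominatedKernel μ k w) (F : Lp ℝ 2 μ) (x : α) :
    ∫ y, k x y * F y ∂μ = inner ℝ F ((h.memLp_row x).toLp (k x)) := by
  rw [L2.inner_def]
  refine integral_congr_ae ?_
  filter_upwards [(h.memLp_row x).coeFn_toLp] with y hy
  rw [hy]
  simp

theorem abs_integral_le (h : IsDominatedKernel μ k w) (F : Lp ℝ 2 μ) (x : α) :
    |∫ y, k x y * F y ∂μ| ≤ ‖h.memLp.toLp w‖ * ‖F‖ * w x := by
  rw [h.integral_eq_inner F x]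
  refine (abs_real_inner_le_norm _ _).trans ?_
  have := mul_le_mul_of_nonneg_left (h.norm_toLp_row_le x) (norm_nonneg F)
  linarith

variable [SFinite μ]

theorem memLp_integral (h : IsDominatedKernel μ k w) (F : Lp ℝ 2 μ) :
    MemLp (fun x => ∫ y, k x y * F y ∂μ) 2 μ := by
  refine (h.memLp.const_mul (‖h.memLp.toLp w‖ * ‖F‖)).of_le ?_ (Eventually.of_forall fun x => ?_)
  · have hm : StronglyMeasurable (Function.uncurry fun x y => k x y * F y) :=
      h.stronglyMeasurable.mul ((Lp.stronglyMeasurable F).comp_measurable measurable_snd)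
    exact hm.integral_prod_right.aestronglyMeasurable
  · rw [norm_mul, norm_mul, norm_norm, norm_norm, Real.norm_of_nonneg (h.nonneg x)]
    exact h.abs_integral_le F x

/-- The integral operator on `L²` given by a dominated kernel. -/
def toCLM (h : IsDominatedKernel μ k w) : Lp ℝ 2 μ →L[ℝ] Lp ℝ 2 μ :=
  LinearMap.mkContinuous
    { toFun := fun F => (h.memLp_integral F).toLp _
      map_add' := fun F G => by
        rw [← MemLp.toLp_add]
        refine MemLp.toLp_congr _ _ (Eventually.of_forall fun x => ?_)
        simp only [Pi.add_apply, h.integral_eq_inner, inner_add_left]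
      map_smul' := fun r F => by
        rw [RingHom.id_apply, ← MemLp.toLp_const_smul]
        refine MemLp.toLp_congr _ _ (Eventually.of_forall fun x => ?_)
        simp only [Pi.smul_apply, h.integral_eq_inner, inner_smul_left, conj_trivial, smul_eq_mul] }
    (‖h.memLp.toLp w‖ * ‖h.memLp.toLp w‖) fun F => by
      rw [mul_right_comm]
      refine Lp.norm_le_mul_norm_of_ae_le_mul ?_
      simp only [LinearMap.coe_mk, AddHom.coe_mk]
      filter_upwards [(h.memLp_integral F).coeFn_toLp, h.memLp.coeFn_toLp] with x hx hw
      rw [hx, hw, Real.norm_of_nonneg (h.nonneg x)]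
      exact h.abs_integral_le F x

theorem coeFn_toCLM (h : IsDominatedKernel μ k w) (F : Lp ℝ 2 μ) :
    h.toCLM F =ᵐ[μ] fun x => ∫ y, k x y * F y ∂μ :=
  (h.memLp_integral F).coeFn_toLp

theorem isSymmetric_toCLM (h : IsDominatedKernel μ k w) : h.toCLM.IsSymmetric := by
  intro F G
  have hint : Integrable (Function.uncurry fun x y => k x y * F y * G x) (μ.prod μ) := by
    have h1 : Integrable (fun x => w x * G x) μ := h.memLp.integrable_mul (Lp.memLp G)
    have h2 : Integrable (fun x => w x * F x) μ := h.memLp.integrable_mul (Lp.memLp F)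
    refine (h1.mul_prod h2).mono ?_ (Eventually.of_forall fun z => ?_)
    · have hm : StronglyMeasurable (Function.uncurry fun x y => k x y * F y * G x) :=
        (h.stronglyMeasurable.mul ((Lp.stronglyMeasurable F).comp_measurable measurable_snd)).mul
          ((Lp.stronglyMeasurable G).comp_measurable measurable_fst)
      exact hm.aestronglyMeasurable
    · simp only [Function.uncurry, norm_mul, Real.norm_eq_abs]
      rw [abs_of_nonneg (h.nonneg z.1), abs_of_nonneg (h.nonneg z.2)]
      have := mul_le_mul_of_nonneg_right (h.bound z.1 z.2)
        (mul_nonneg (abs_nonneg (F z.2)) (abs_nonneg (G z.1)))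
      linarith
  have e1 : inner ℝ (h.toCLM F) G = ∫ x, ∫ y, k x y * F y * G x ∂μ ∂μ := by
    rw [L2.inner_def]
    refine integral_congr_ae ?_
    filter_upwards [h.coeFn_toCLM F] with x hx
    rw [hx, integral_mul_const]
    simp [mul_comm]
  have e2 : inner ℝ F (h.toCLM G) = ∫ y, ∫ x, k x y * F y * G x ∂μ ∂μ := by
    rw [L2.inner_def]
    refine integral_congr_ae ?_
    filter_upwards [h.coeFn_toCLM G] with y hy
    rw [hy]
    simp only [RCLike.inner_apply, conj_trivial]
    rw [← integral_mul_const]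
    congr 1
    ext x
    rw [h.symm x y]
    ring
  simp only [ContinuousLinearMap.coe_coe]
  rw [e1, e2]
  exact integral_integral_swap hint

theorem isCompactOperator_toCLM (h : IsDominatedKernel μ k w) : IsCompactOperator h.toCLM := by
  obtain ⟨s, e, -⟩ := exists_hilbertBasis ℝ (Lp ℝ 2 μ)
  refine h.toCLM.isCompactOperator_of_summable_norm_sq h.isSymmetric_toCLM e ?_
  -- The Hilbert–Schmidt bound: Bessel's inequality for the row `k x`, whose norm is at most w x
  -- ‖w‖, integrated over x.
  refine summable_of_sum_le (c := ∫ x, (w x * ‖h.memLp.toLp w‖) ^ 2 ∂μ)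
    (fun i => sq_nonneg _) fun t => ?_
  have hi : ∀ i, Integrable (fun x => (∫ y, k x y * e i y ∂μ) ^ 2) μ := fun i =>
    (h.memLp_integral (e i)).integrable_sq
  have hn : ∀ i, ‖h.toCLM (e i)‖ ^ 2 = ∫ x, (∫ y, k x y * e i y ∂μ) ^ 2 ∂μ := by
    intro i
    rw [← real_inner_self_eq_norm_sq, L2.inner_def]
    refine integral_congr_ae ?_
    filter_upwards [h.coeFn_toCLM (e i)] with x hx
    rw [hx, real_inner_self_eq_norm_sq, Real.norm_eq_abs, sq_abs]
  simp_rw [hn]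
  rw [← integral_finsetSum _ fun i _ => hi i]
  refine integral_mono (integrable_finsetSum _ fun i _ => hi i)
    (h.memLp.mul_const _).integrable_sq fun x => ?_
  have hb := e.orthonormal.sum_inner_products_le ((h.memLp_row x).toLp (k x)) (s := t)
  simp only [h.integral_eq_inner]
  simp only [Real.norm_eq_abs, sq_abs] at hb
  exact hb.trans (pow_le_pow_left₀ (norm_nonneg _) (h.norm_toLp_row_le x) 2)

end IsDominatedKernel

end KernelOperator

/-! ### The Airy operator on the half-line -/

section AiryOperator

theorem isDominatedKernel_airyAi (c : ℝ) :
    IsDominatedKernel (volume.restrict (Ici (0 : ℝ))) (fun x y => airyAi (x + y + c))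
      (fun x => Real.exp (-(c / 2)) * Real.exp (-x)) where
  stronglyMeasurable := by
    have := continuous_airyAi
    exact Continuous.stronglyMeasurable (by unfold Function.uncurry; fun_prop)
  memLp := (memLp_exp_neg_Ici 0).const_mul _
  nonneg := fun x => by positivity
  symm := fun x y => by rw [add_comm x y]
  bound := fun x y => by
    refine (abs_airyAi_le_exp_neg _).trans_eq ?_
    rw [← Real.exp_add, ← Real.exp_add, ← Real.exp_add]
    congr 1
    ring

theorem airyOp_congr_ae {c : ℝ} {f g : ℝ → ℝ} (h : f =ᵐ[volume.restrict (Ici (0 : ℝ))] g) :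
    airyOp c f = airyOp c g := by
  ext x
  refine integral_congr_ae ?_
  filter_upwards [h] with y hy
  rw [hy]

theorem coeFn_toCLM_toLp_airyOp (c : ℝ) {f : ℝ → ℝ}
    (hf : MemLp f 2 (volume.restrict (Ici (0 : ℝ)))) :
    (isDominatedKernel_airyAi c).toCLM (hf.toLp f) =ᵐ[volume.restrict (Ici (0 : ℝ))]
      airyOp c f := by
  rw [← airyOp_congr_ae hf.coeFn_toLp]
  exact (isDominatedKernel_airyAi c).coeFn_toCLM _

theorem memLp_airyOp (c : ℝ) {f : ℝ → ℝ} (hf : MemLp f 2 (volume.restrict (Ici (0 : ℝ)))) :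
    MemLp (airyOp c f) 2 (volume.restrict (Ici (0 : ℝ))) :=
  (memLp_congr_ae (coeFn_toCLM_toLp_airyOp c hf)).1 (Lp.memLp _)

theorem airyOp_exp_neg_pos {c x : ℝ} (hx : 4 - c ≤ x) :
    0 < airyOp c (fun y => Real.exp (-y)) x := by
  have hpos : ∀ y ∈ Ici (0 : ℝ), 0 < airyAi (x + y + c) * Real.exp (-y) := fun y hy =>
    mul_pos (airyAi_pos (by linarith [mem_Ici.1 hy])) (Real.exp_pos _)
  have hint : IntegrableOn (fun y => airyAi (x + y + c) * Real.exp (-y)) (Ici 0) :=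
    ((isDominatedKernel_airyAi c).memLp_row x).integrable_mul (memLp_exp_neg_Ici 0)
  rw [airyOp, setIntegral_pos_iff_support_of_nonneg_ae
    ((ae_restrict_iff' measurableSet_Ici).2 (Eventually.of_forall fun y hy => (hpos y hy).le)) hint]
  have : Function.support (fun y => airyAi (x + y + c) * Real.exp (-y)) ∩ Ici 0 = Ici 0 :=
    inter_eq_right.2 fun y hy => (hpos y hy).ne'
  rw [this, Real.volume_Ici]
  exact ENNReal.zero_lt_top

/-- The image of exp(-y) is positive on a half-line, by positivity of Ai on [4,∞). A nonzero
operator is needed in order to divide by the eigenvalue. -/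
theorem toCLM_airyAi_ne_zero (c : ℝ) : (isDominatedKernel_airyAi c).toCLM ≠ 0 := by
  intro h0
  have h := coeFn_toCLM_toLp_airyOp c (memLp_exp_neg_Ici 0)
  rw [h0, zero_apply] at h
  have h1 : ∀ᵐ x ∂(volume.restrict (Ici (0 : ℝ))), x < 4 - c := by
    filter_upwards [h, Lp.coeFn_zero ℝ 2 (volume.restrict (Ici (0 : ℝ)))] with x hx hx0
    by_contra hlt
    rw [hx0, Pi.zero_apply] at hx
    exact (airyOp_exp_neg_pos (not_lt.1 hlt)).ne hx
  rw [ae_restrict_iff' measurableSet_Ici, ae_iff] at h1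
  have h2 : Ici (max 0 (4 - c)) ⊆ {x | ¬(x ∈ Ici (0 : ℝ) → x < 4 - c)} := fun x hx hlt =>
    absurd (hlt (mem_Ici.2 ((le_max_left _ _).trans hx))) (not_lt.2 ((le_max_right _ _).trans hx))
  have h3 := measure_mono_null h2 h1
  rw [Real.volume_Ici] at h3
  exact ENNReal.top_ne_zero h3

theorem integral_sq_eq_norm_toLp_sq {α : Type*} [MeasurableSpace α] {μ : Measure α} {f : α → ℝ}
    (hf : MemLp f 2 μ) : ∫ x, f x ^ 2 ∂μ = ‖hf.toLp f‖ ^ 2 := by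
  rw [hf.integral_sq_eq_toReal_eLpNorm_sq, Lp.norm_toLp]

/-- The Airy operator has a normalized eigenfunction with a nonzero eigenvalue whose modulus is the
operator norm. -/
theorem exists_dominant_airyEigenfunction (c : ℝ) :
    ∃ (lam : ℝ) (ψ : ℝ → ℝ), IsAiryEigenfunction c lam ψ ∧
      ∀ f : ℝ → ℝ, MemLp f 2 (volume.restrict (Ici (0 : ℝ))) →
        ∫ x in Ici (0 : ℝ), airyOp c f x ^ 2 ≤ lam ^ 2 * ∫ x in Ici (0 : ℝ), f x ^ 2 := by
  have hk := isDominatedKernel_airyAi c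
  obtain ⟨lam, v, hlam, hv, hTv⟩ := hk.toCLM.exists_eigenvector_abs_eq_norm
    hk.isSymmetric_toCLM hk.isCompactOperator_toCLM (toCLM_airyAi_ne_zero c)
  have hlam0 : lam ≠ 0 := by
    rintro rfl
    rw [abs_zero] at hlam
    exact toCLM_airyAi_ne_zero c (norm_eq_zero.1 hlam.symm)
  -- The eigenvector is only a class modulo null sets. This representative satisfies the eigenvalue
  -- equation at every x ≥ 0, since `airyOp` depends only on the class.
  have hae : (fun x => lam⁻¹ * airyOp c v x) =ᵐ[volume.restrict (Ici (0 : ℝ))] v := by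
    have h1 := hk.coeFn_toCLM v
    rw [hTv] at h1
    filter_upwards [h1, Lp.coeFn_smul lam v] with x hx hx'
    rw [hx', Pi.smul_apply, smul_eq_mul] at hx
    rw [inv_mul_eq_iff_eq_mul₀ hlam0]
    exact hx.symm
  have hmem : MemLp (fun x => lam⁻¹ * airyOp c v x) 2 (volume.restrict (Ici (0 : ℝ))) :=
    (memLp_congr_ae hae).2 (Lp.memLp v)
  refine ⟨lam, fun x => lam⁻¹ * airyOp c v x, ⟨hmem, ?_, fun x _ => ?_⟩, fun f hf => ?_⟩
  · rw [hmem.integral_sq_eq_toReal_eLpNorm_sq, eLpNorm_congr_ae hae, ← Lp.norm_def, hv, one_pow]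
  · rw [airyOp_congr_ae hae, mul_inv_cancel_left₀ hlam0]
  · have hae' := coeFn_toCLM_toLp_airyOp c hf
    rw [(memLp_airyOp c hf).integral_sq_eq_toReal_eLpNorm_sq, ← eLpNorm_congr_ae hae',
      ← Lp.norm_def, integral_sq_eq_norm_toLp_sq hf, ← sq_abs lam, hlam, ← mul_pow]
    exact pow_le_pow_left₀ (norm_nonneg _) (hk.toCLM.le_opNorm _) 2

end AiryOperator

end

/-! ### Translation to [0,∞) -/

section HalfLineTranslation

theorem preimage_add_right_Ici_self (a : ℝ) : (fun y : ℝ => y + a) ⁻¹' Ici a = Ici 0 := by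
  ext y; simp

theorem setIntegral_Ici_eq_comp_add_right (g : ℝ → ℝ) (a : ℝ) :
    ∫ y in Ici a, g y = ∫ y in Ici (0 : ℝ), g (y + a) := by
  rw [← preimage_add_right_Ici_self a]
  exact ((measurePreserving_add_right volume a).setIntegral_preimage_emb
    (measurableEmbedding_addRight a) g (Ici a)).symm

/-- This identity converts energy on [b,∞) into the norm of an image under the Airy operator. -/
theorem airyTransformFrom_add (a b : ℝ) (σ : ℝ → ℝ) (x : ℝ) :
    airyTransformFrom a σ (x + b) = airyOp (a + b) (fun y => σ (y + a)) x := by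
  rw [airyTransformFrom, setIntegral_Ici_eq_comp_add_right, airyOp]
  congr 1
  ext y
  congr 2
  ring

theorem integral_Ici_airyTransformFrom_sq (a b : ℝ) (σ : ℝ → ℝ) :
    ∫ x in Ici b, airyTransformFrom a σ x ^ 2
      = ∫ x in Ici (0 : ℝ), airyOp (a + b) (fun y => σ (y + a)) x ^ 2 := by
  rw [setIntegral_Ici_eq_comp_add_right]
  simp_rw [airyTransformFrom_add]

theorem integral_sq_eq_of_supported {a : ℝ} {σ : ℝ → ℝ} (hs : ∀ᵐ y : ℝ, y < a → σ y = 0) :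
    ∫ y in Ici (0 : ℝ), σ (y + a) ^ 2 = ∫ y, σ y ^ 2 := by
  rw [← setIntegral_Ici_eq_comp_add_right fun y => σ y ^ 2]
  refine setIntegral_eq_integral_of_ae_compl_eq_zero ?_
  filter_upwards [hs] with y hy hya
  rw [hy (not_le.1 hya), sq, mul_zero]

theorem memLp_comp_add_right_Ici {a : ℝ} {σ : ℝ → ℝ} (hσ : MemLp σ 2 volume) :
    MemLp (fun y => σ (y + a)) 2 (volume.restrict (Ici (0 : ℝ))) :=
  (hσ.comp_measurePreserving (measurePreserving_add_right volume a)).restrict _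

theorem translateFrom_add {a : ℝ} (ψ : ℝ → ℝ) {y : ℝ} (hy : 0 ≤ y) :
    translateFrom a ψ (y + a) = ψ y := by
  rw [translateFrom, indicator_of_mem (by simpa using hy), add_sub_cancel_right]

theorem translateFrom_supported (a : ℝ) (ψ : ℝ → ℝ) :
    ∀ᵐ y : ℝ, y < a → translateFrom a ψ y = 0 :=
  Eventually.of_forall fun _ hy => indicator_of_notMem (not_le.2 hy) _

theorem memLp_translateFrom (a : ℝ) {ψ : ℝ → ℝ} (hψ : MemLp ψ 2 (volume.restrict (Ici (0 : ℝ)))) :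
    MemLp (translateFrom a ψ) 2 volume := by
  rw [translateFrom, memLp_indicator_iff_restrict measurableSet_Ici]
  have hmp := (measurePreserving_sub_right (volume : Measure ℝ) a).restrict_preimage
    (measurableSet_Ici (a := (0 : ℝ)))
  have hpre : (fun y : ℝ => y - a) ⁻¹' Ici 0 = Ici a := by ext y; simp
  rw [hpre] at hmp
  exact hψ.comp_measurePreserving hmp

end HalfLineTranslation

/-! ### The extremal problem -/

section Extremal

theorem IsAiryEigenfunction.integral_airyOp_sq {c lam : ℝ} {ψ : ℝ → ℝ}
    (h : IsAiryEigenfunction c lam ψ) : ∫ x in Ici (0 : ℝ), airyOp c ψ x ^ 2 = lam ^ 2 := by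
  have e : ∫ x in Ici (0 : ℝ), airyOp c ψ x ^ 2 = ∫ x in Ici (0 : ℝ), lam ^ 2 * ψ x ^ 2 :=
    setIntegral_congr_fun measurableSet_Ici fun x hx => by simp only [h.eigen x hx, mul_pow]
  rw [e, integral_const_mul, h.norm_sq, mul_one]

theorem exists_isFirstAiryEigenpair (c : ℝ) :
    ∃ (lam : ℝ) (ψ : ℝ → ℝ), IsFirstAiryEigenpair c lam ψ := by
  obtain ⟨lam, ψ, hψ, hmax⟩ := exists_dominant_airyEigenfunction c
  refine ⟨lam, ψ, hψ, ?_⟩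
  rintro ν ⟨φ, hφ⟩
  have h := hmax φ hφ.memLp
  rw [hφ.integral_airyOp_sq, hφ.norm_sq, mul_one] at h
  exact sq_le_sq.1 h

/-- Maximality compares the given eigenvalue with the dominant one already constructed, so the norm
bound holds for every first eigenpair. -/
theorem IsFirstAiryEigenpair.integral_airyOp_sq_le {c lam : ℝ} {ψ : ℝ → ℝ}
    (h : IsFirstAiryEigenpair c lam ψ) {f : ℝ → ℝ}
    (hf : MemLp f 2 (volume.restrict (Ici (0 : ℝ)))) :
    ∫ x in Ici (0 : ℝ), airyOp c f x ^ 2 ≤ lam ^ 2 * ∫ x in Ici (0 : ℝ), f x ^ 2 := by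
  obtain ⟨ν, φ, hφ, hmax⟩ := exists_dominant_airyEigenfunction c
  exact (hmax f hf).trans (mul_le_mul_of_nonneg_right (sq_le_sq.2 (h.largest ν ⟨φ, hφ⟩))
    (integral_nonneg fun x => sq_nonneg _))

/-- Cauchy–Schwarz in y with ‖ψ‖ = 1 bounds the square of `airyOp c ψ x` by the squared norm of the
kernel row; then integrate over x. -/
theorem IsAiryEigenfunction.sq_le_integral_kernel_sq {c lam : ℝ} {ψ : ℝ → ℝ}
    (h : IsAiryEigenfunction c lam ψ) :
    lam ^ 2 ≤ ∫ x in Ici (0 : ℝ), ∫ y in Ici (0 : ℝ), airyAi (x + y + c) ^ 2 := by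
  have hk := isDominatedKernel_airyAi c
  rw [← h.integral_airyOp_sq]
  have hrow : ∀ x, ∫ y in Ici (0 : ℝ), airyAi (x + y + c) ^ 2
      = ‖(hk.memLp_row x).toLp _‖ ^ 2 := fun x => integral_sq_eq_norm_toLp_sq (hk.memLp_row x)
  -- Monotonicity needs this: a non-integrable right side would have integral 0 by convention.
  have hint : Integrable (fun x => ∫ y in Ici (0 : ℝ), airyAi (x + y + c) ^ 2)
      (volume.restrict (Ici (0 : ℝ))) := by
    refine (hk.memLp.mul_const ‖hk.memLp.toLp _‖).integrable_sq.mono' ?_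
      (Eventually.of_forall fun x => ?_)
    · have hm : StronglyMeasurable (Function.uncurry fun x y : ℝ => airyAi (x + y + c) ^ 2) :=
        hk.stronglyMeasurable.pow 2
      exact hm.integral_prod_right.aestronglyMeasurable
    · rw [hrow, Real.norm_of_nonneg (sq_nonneg _)]
      exact pow_le_pow_left₀ (norm_nonneg _) (hk.norm_toLp_row_le x) 2
  refine integral_mono_of_nonneg (Eventually.of_forall fun x => sq_nonneg _) hint
    (Eventually.of_forall fun x => ?_)
  simp only [hrow]
  have hψ1 : ‖h.memLp.toLp ψ‖ = 1 := by
    have h1 := integral_sq_eq_norm_toLp_sq h.memLp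
    rw [h.norm_sq] at h1
    exact (pow_eq_one_iff_of_nonneg (norm_nonneg _) two_ne_zero).1 h1.symm
  have h2 := hk.integral_eq_inner (h.memLp.toLp ψ) x
  have h3 : airyOp c ψ x = inner ℝ (h.memLp.toLp ψ) ((hk.memLp_row x).toLp _) := by
    rw [← h2, ← airyOp_congr_ae h.memLp.coeFn_toLp, airyOp]
  rw [h3, ← sq_abs]
  refine pow_le_pow_left₀ (abs_nonneg _) ?_ 2
  have h4 := abs_real_inner_le_norm (h.memLp.toLp ψ) ((hk.memLp_row x).toLp _)
  rwa [hψ1, one_mul] at h4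

theorem IsAiryBandlimited.integrable_sq {a : ℝ} {f σ : ℝ → ℝ} (h : IsAiryBandlimited a f σ) :
    Integrable (fun x => f x ^ 2) volume := by
  obtain rfl : f = airyTransformFrom a σ := funext h.repr
  exact (airyTransformFrom_isometry h.memLp h.supported).1.integrable_sq

theorem IsAiryBandlimited.integral_sq {a : ℝ} {f σ : ℝ → ℝ} (h : IsAiryBandlimited a f σ) :
    ∫ x, f x ^ 2 = ∫ y, σ y ^ 2 := by
  obtain rfl : f = airyTransformFrom a σ := funext h.repr
  exact integral_airyTransformFrom_sq h.memLp h.supported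

/-- By Parseval, zero energy forces σ = 0 almost everywhere, and then the defining integral vanishes
at every x, not just almost every x. -/
theorem IsAiryBandlimited.integral_sq_pos {a : ℝ} {f σ : ℝ → ℝ} (h : IsAiryBandlimited a f σ)
    (hf : f ≠ 0) : 0 < ∫ x, f x ^ 2 := by
  rw [h.integral_sq]
  refine (integral_nonneg fun y => sq_nonneg _).lt_of_ne' fun h0 => hf ?_
  rw [integral_eq_zero_iff_of_nonneg (fun y => sq_nonneg _) h.memLp.integrable_sq] at h0
  have hσ : ∀ᵐ y : ℝ, σ y = 0 := by
    filter_upwards [h0] with y hy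
    exact pow_eq_zero_iff two_ne_zero |>.1 hy
  ext x
  rw [h.repr x, airyTransformFrom, Pi.zero_apply]
  refine integral_eq_zero_of_ae ?_
  filter_upwards [ae_restrict_of_ae hσ] with y hy
  rw [hy, mul_zero, Pi.zero_apply]

theorem IsAiryBandlimited.energyFraction_le {a b lam : ℝ} {f σ ψ : ℝ → ℝ}
    (h : IsAiryBandlimited a f σ) (hf : f ≠ 0) (hψ : IsFirstAiryEigenpair (a + b) lam ψ) :
    energyFraction b f ≤ lam ^ 2 := by
  rw [energyFraction, div_le_iff₀ (h.integral_sq_pos hf), h.integral_sq,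
    ← integral_sq_eq_of_supported h.supported]
  obtain rfl : f = airyTransformFrom a σ := funext h.repr
  rw [integral_Ici_airyTransformFrom_sq]
  exact hψ.integral_airyOp_sq_le (memLp_comp_add_right_Ici h.memLp)

theorem isAiryBandlimited_translateFrom (a : ℝ) {ψ : ℝ → ℝ}
    (hψ : MemLp ψ 2 (volume.restrict (Ici (0 : ℝ)))) :
    IsAiryBandlimited a (airyTransformFrom a (translateFrom a ψ)) (translateFrom a ψ) :=
  ⟨memLp_translateFrom a hψ, translateFrom_supported a ψ, fun _ => rfl⟩

theorem IsAiryEigenfunction.integral_airyTransformFrom_translateFrom_sq {a c lam : ℝ} {ψ : ℝ → ℝ}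
    (h : IsAiryEigenfunction c lam ψ) :
    ∫ x, airyTransformFrom a (translateFrom a ψ) x ^ 2 = 1 := by
  rw [(isAiryBandlimited_translateFrom a h.memLp).integral_sq,
    ← integral_sq_eq_of_supported (translateFrom_supported a ψ), ← h.norm_sq]
  exact setIntegral_congr_fun measurableSet_Ici fun y hy => by
    simp only [translateFrom_add ψ (mem_Ici.1 hy)]

theorem IsAiryEigenfunction.energyFraction_translateFrom {a b lam : ℝ} {ψ : ℝ → ℝ}
    (h : IsAiryEigenfunction (a + b) lam ψ) :
    energyFraction b (airyTransformFrom a (translateFrom a ψ)) = lam ^ 2 := by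
  rw [energyFraction, h.integral_airyTransformFrom_translateFrom_sq, div_one,
    integral_Ici_airyTransformFrom_sq, ← h.integral_airyOp_sq]
  rw [airyOp_congr_ae (g := ψ)]
  exact (ae_restrict_iff' measurableSet_Ici).2
    (Eventually.of_forall fun y hy => translateFrom_add ψ (mem_Ici.1 hy))

end Extremal

theorem theorem3p8 (a b : ℝ) :
    -- the first eigenvalue and eigenfunction exist
    (∃ (lam : ℝ) (ψ : ℝ → ℝ), IsFirstAiryEigenpair (a + b) lam ψ) ∧
    -- the energy fraction of a nonzero Airy-bandlimited function is a genuine quotient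
    (∀ f σ : ℝ → ℝ, IsAiryBandlimited a f σ → f ≠ 0 →
      Integrable (fun x => f x ^ 2) volume ∧ 0 < ∫ x, f x ^ 2) ∧
    ∀ (lam : ℝ) (ψ : ℝ → ℝ), IsFirstAiryEigenpair (a + b) lam ψ →
      -- the maximum of the energy fraction is the square of the first eigenvalue
      IsGreatest {r : ℝ | ∃ f σ : ℝ → ℝ,
          IsAiryBandlimited a f σ ∧ f ≠ 0 ∧ r = energyFraction b f} (lam ^ 2) ∧
      -- it is attained at the translated first eigenfunction
      (IsAiryBandlimited a (airyTransformFrom a (translateFrom a ψ)) (translateFrom a ψ) ∧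
        airyTransformFrom a (translateFrom a ψ) ≠ 0 ∧
        energyFraction b (airyTransformFrom a (translateFrom a ψ)) = lam ^ 2) ∧
      -- the bound by the first eigenvalue refines the bound of the uncertainty principle
      lam ^ 2 ≤ ∫ x in Ici b, ∫ y in Ici a, airyAi (x + y) ^ 2 := by

  refine ⟨exists_isFirstAiryEigenpair (a + b),
    fun f σ h hf => ⟨h.integrable_sq, h.integral_sq_pos hf⟩, fun lam ψ hψ => ?_⟩
  have hband := isAiryBandlimited_translateFrom a hψ.eigenfunction.memLp
  have hne : airyTransformFrom a (translateFrom a ψ) ≠ 0 := by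
    intro h0
    have h1 := hψ.eigenfunction.integral_airyTransformFrom_translateFrom_sq (a := a)
    simp [h0] at h1
  have hval := hψ.eigenfunction.energyFraction_translateFrom
  refine ⟨⟨⟨_, _, hband, hne, hval.symm⟩, ?_⟩, ⟨hband, hne, hval⟩, ?_⟩
  · rintro r ⟨f, σ, h, hf, rfl⟩
    exact h.energyFraction_le hf hψ
  · refine hψ.eigenfunction.sq_le_integral_kernel_sq.trans_eq ?_
    rw [setIntegral_Ici_eq_comp_add_right _ b]
    refine integral_congr_ae (Eventually.of_forall fun x => ?_)
    simp only
    rw [setIntegral_Ici_eq_comp_add_right _ a]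
    refine integral_congr_ae (Eventually.of_forall fun y => ?_)
    simp only
    congr 2
    ring
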